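/- **Setting.** Let $m\in(0,4]$. Put $\alpha=\frac1{4-m}$ if $m\in(0,4)$, and $\alpha=b$ with an arbitrary $b>0$ if $m=4$. Let $f:[0,\infty)\to\mathbb R$ be a solution of $$\alpha\,(f-yf_y)+(f^m f_{yyy})_y=0\quad\text{for } y\in(0,\infty),$$ $$f(0)=1,\quad f_y(0)=0,\quad f_{yy}(0)=\kappa,\quad f_{yyy}(0)=0,\qquad \frac{f(y)}{y}\to a\quad\text{as } y\to\infty,$$ for some $\kappa>0$ and some $a>0$ ($f\in C^3([0,\infty))$ with $f^mf_{yyy}$ differentiable on $(0,\infty)$). Let $h$ be the corresponding self-similar solution of the thin-film equation $h_t+(h^mh_{xxx})_x=0$, and let $h_{\rm in}(x)=a|x|$. 1. Let $m\in(0,4)$ and $h(x,t)=t^{\alpha}f\big(|x|/t^{\alpha}\big)$ for $x\in\mathbb R$, $t>0$. Then there exist constants $d_0,D_0>0$ (independent of $t$) such that for all $t>0$ the function $h_x(\cdot,t)^2-h_{{\rm in},x}^2$ is integrable on $\mathbb R$ and $$-t^{\alpha}d_0<\frac12\int_{-\infty}^{\infty}\big(h_x(x,t)^2-h_{{\rm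 in},x}(x)^2\big)\,dx\le -t^{\alpha}D_0 .$$ In particular $h$ has finite positive dissipation: for every $t>0$, $$0<\int_{\mathbb R}h^mh_{xxx}^2\,dx<\infty\quad\text{at time } t,\qquad 0<\int_0^t\int_{\mathbb R}h^mh_{xxx}^2\,dx\,ds<\infty .$$ 2. Let $m=4$ and $h(x,t)=e^{bt}f\big(|x|/e^{bt}\big)$ for $x\in\mathbb R$, $t\in\mathbb R$. Then there exist constants $d_0,D_0>0$ (independent of $t$) such that for all $t\in\mathbb R$ the function $h_x(\cdot,t)^2-h_{{\rm in},x}^2$ is integrable on $\mathbb R$ and $$-e^{bt}d_0<\frac12\int_{-\infty}^{\infty}\big(h_x(x,t)^2-h_{{\rm in},x}(x)^2\big)\,dx\le -e^{bt}D_0 .$$ In particular $h$ has finite positive dissipation: for every $t\in\mathbb R$, $$0<\int_{\mathbb R}h^4h_{xxx}^2\,dx<\infty\quad\text{at time } t,\qquad 0<\int_{-\infty}^t\int_{\mathbb R}h^4h_{xxx}^2\,dx\,ds<\infty .$$ -/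

import Mathlib

open MeasureTheory Set Filter Topology

noncomputable section

/-- The `k`-th derivative of a profile `f : [0,∞) → ℝ` (one-sided at `0`). Only the values of
`f` on `[0,∞)` matter. -/
def profileDeriv (k : ℕ) (f : ℝ → ℝ) (y : ℝ) : ℝ :=
  iteratedDerivWithin k f (Ici 0) y

/-- `f` is a (classical) solution on `[0,∞)` of
`α (f - y f_y) + (f^m f_yyy)_y = 0` for `y ∈ (0,∞)`, with
`f(0) = 1`, `f_y(0) = 0`, `f_yy(0) = κ > 0`, `f_yyy(0) = 0` and
`f(y)/y → a > 0` as `y → ∞`. -/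
structure IsProfile (m α κ a : ℝ) (f : ℝ → ℝ) : Prop where
  contDiffOn : ContDiffOn ℝ 3 f (Ici 0)
  ode : ∀ y : ℝ, 0 < y →
    HasDerivAt (fun s => f s ^ m * profileDeriv 3 f s)
      (-(α * (f y - y * profileDeriv 1 f y))) y
  init_zero : f 0 = 1
  init_one : profileDeriv 1 f 0 = 0
  init_two : profileDeriv 2 f 0 = κ
  kappa_pos : 0 < κ
  init_three : profileDeriv 3 f 0 = 0
  slope_pos : 0 < a
  linear_growth : Tendsto (fun y => f y / y) atTop (𝓝 a)

/-- `h(x,t) = t^α f(|x| / t^α)`, `t > 0`. -/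
def powerSelfSimilar (α : ℝ) (f : ℝ → ℝ) (x t : ℝ) : ℝ :=
  t ^ α * f (|x| / t ^ α)

/-- `h(x,t) = e^{bt} f(|x| / e^{bt})`, `t ∈ ℝ`. -/
def expSelfSimilar (b : ℝ) (f : ℝ → ℝ) (x t : ℝ) : ℝ :=
  Real.exp (b * t) * f (|x| / Real.exp (b * t))

/-- The cone `h_in(x) = a|x|`. -/
def cone (a : ℝ) (x : ℝ) : ℝ := a * |x|

/-- The integrand `h_x(x,t)² - h_{in,x}(x)²`. -/
def energyDensityChange (h : ℝ → ℝ → ℝ) (hin : ℝ → ℝ) (t x : ℝ) : ℝ :=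
  deriv (fun z => h z t) x ^ 2 - deriv hin x ^ 2

/-- The dissipation rate `∫ h^m h_xxx² dx` at time `t`, as a value in `[0,∞]`. -/
def dissipationRate (m : ℝ) (h : ℝ → ℝ → ℝ) (t : ℝ) : ENNReal :=
  ∫⁻ x : ℝ, ENNReal.ofReal (h x t ^ m * iteratedDeriv 3 (fun z => h z t) x ^ 2)

end

/-! ### Monotone functions on half-lines -/

/-! Let `w = f^m f'''` be the flux and `z = w' = -α(f - y f')`, so that `z' = α y f''`. If `T` is
the similarity scale (`t^α` or `e^{bt}`), changing variables turns half the energy change into `T E`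
with `E = ∫₀^∞ (f'² - a²)`, and the dissipation rate into `T^(m-3)` times a fixed integral. It
remains to show that `E` converges and is negative, and that `∫ f^m f'''²` is finite and positive.

The sign of `E` comes from `(α(f f' - y f'²/2) + w f'')' = α f'²/2 + f^m f'''²`. Subtracting the
energy of the cone and integrating to `Y` bounds the boundary term above by `α(f - aY)f' +
z²/(2αY)`, which tends to zero (`integral_first_sq_sub_neg`). The same identity, used up to a first
zero, gives `pos`.

The hard part is decay, since only `f/y → a` is assumed. The quantity `w f'' - z²/(2αy)` is
nondecreasing, and it is nonpositive because otherwise `|f''|` would grow, against linear growth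
(`monotoneQuantity_nonpos`). Hence its derivative is integrable, which settles the dissipation. In
the scaled variables `P = y^(m/2) f'''`, `U = y^(m/2) f''/y`, `Z = z/y` this controls `P` and `Z` in
`L²`; a multiplier argument adds `U` (`exists_integrableOn_scaledNormSq`).

A corrected energy `R` then satisfies `R' = F₀` and `(y^K R)' = y^K F_K`, with both quadratic forms
eventually coercive (`exists_coercive_form`). Square integrability forces `R ≤ 0`, so `y^K (P² + U²
+ Z²)` is integrable. As `K + m - 2 > 3`, this makes `y^β f''` integrable for some `β > 1`, hence
`f' - a = O(y^(-β))`, `z → 0` and `f - ay → 0`. -/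

lemma monotoneOn_Ici_of_hasDerivAt {g g' : ℝ → ℝ} {a : ℝ}
    (hg : ∀ x ∈ Ici a, HasDerivAt g (g' x) x) (h0 : ∀ x ∈ Ici a, 0 ≤ g' x) :
    MonotoneOn g (Ici a) := by
  refine monotoneOn_of_deriv_nonneg (convex_Ici a)
    (fun x hx => (hg x hx).continuousAt.continuousWithinAt)
    (fun x hx => (hg x (interior_subset hx)).differentiableAt.differentiableWithinAt) ?_
  intro x hx
  rw [(hg x (interior_subset hx)).deriv]
  exact h0 x (interior_subset hx)

lemma linear_lower_bound_of_le_deriv {g g' : ℝ → ℝ} {a c : ℝ}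
    (hg : ∀ x ∈ Ici a, HasDerivAt g (g' x) x) (h0 : ∀ x ∈ Ici a, c ≤ g' x) {x : ℝ} (hx : a ≤ x) :
    g a + c * (x - a) ≤ g x := by
  have := monotoneOn_Ici_of_hasDerivAt (g := fun x => g x - c * x) (g' := fun x => g' x - c) (a := a)
    (fun x hx => ((hg x hx).sub ((hasDerivAt_id x).const_mul c)).congr_deriv (by simp))
    (fun x hx => sub_nonneg.2 (h0 x hx)) (self_mem_Ici) hx hx
  simp only at this
  linarith

/-- The Lyapunov principle behind the integrability estimates: a function bounded above can only
absorb a finite amount of nonnegative growth. -/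
lemma integrableOn_Ioi_of_le_deriv {g g' ψ : ℝ → ℝ} {a C : ℝ}
    (hg : ∀ x ∈ Ici a, HasDerivAt g (g' x) x) (hψ : ContinuousOn ψ (Ici a))
    (h0 : ∀ x ∈ Ici a, 0 ≤ ψ x) (hle : ∀ x ∈ Ici a, ψ x ≤ g' x) (hC : ∀ x ∈ Ici a, g x ≤ C) :
    IntegrableOn ψ (Ioi a) := by
  have hmono := monotoneOn_Ici_of_hasDerivAt hg (fun x hx => (h0 x hx).trans (hle x hx))
  have hm : Monotone fun x => g (max a x) := fun x y hxy =>
    hmono (mem_Ici.2 (le_max_left _ _)) (mem_Ici.2 (le_max_left _ _)) (max_le_max le_rfl hxy)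
  have ht := tendsto_atTop_ciSup hm ⟨C, by
    rintro _ ⟨x, rfl⟩
    exact hC _ (mem_Ici.2 (le_max_left _ _))⟩
  have ht' : Tendsto g atTop (𝓝 (⨆ x, g (max a x))) := by
    refine ht.congr' ?_
    filter_upwards [eventually_ge_atTop a] with x hx
    rw [max_eq_right hx]
  have hi := integrableOn_Ioi_deriv_of_nonneg' hg
    (fun x hx => (h0 x (Ioi_subset_Ici_self hx)).trans (hle x (Ioi_subset_Ici_self hx))) ht'
  refine Integrable.mono' hi
    ((hψ.mono Ioi_subset_Ici_self).aestronglyMeasurable measurableSet_Ioi) ?_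
  filter_upwards [ae_restrict_mem measurableSet_Ioi] with x hx
  rw [Real.norm_of_nonneg (h0 x (Ioi_subset_Ici_self hx))]
  exact hle x (Ioi_subset_Ici_self hx)

/-- Logarithmic divergence; the contradiction in each later argument that plays growth or a nonzero
limit against integrability. -/
lemma not_integrableOn_Ioi_of_div_le {ψ : ℝ → ℝ} {a b c : ℝ} (hc : 0 < c)
    (h : ∀ y, b ≤ y → c / y ≤ ψ y) : ¬ IntegrableOn ψ (Ioi a) := by
  intro hi
  have hi' : IntegrableOn ψ (Ioi (max 1 (max a b))) :=
    hi.mono_set (Ioi_subset_Ioi ((le_max_left _ _).trans (le_max_right _ _)))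
  refine not_integrableOn_Ioi_inv (a := max 1 (max a b)) ?_
  refine Integrable.mono' (hi'.const_mul c⁻¹) (by fun_prop) ?_
  filter_upwards [ae_restrict_mem measurableSet_Ioi] with x hx
  have hx : max 1 (max a b) < x := hx
  simp only [max_lt_iff] at hx
  obtain ⟨h1, -, h3⟩ := hx
  have hx0 : 0 < x := by linarith
  rw [Real.norm_of_nonneg (by positivity), ← div_eq_inv_mul, le_div_iff₀ hc]
  have := h x h3.le
  rwa [div_eq_inv_mul] at this

/-! ### The profile equation as a first-order system -/

/-- A profile `f` together with its first three derivatives `f₁, f₂, f₃`. -/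
structure ProfileSystem (m α a : ℝ) (f f₁ f₂ f₃ : ℝ → ℝ) : Prop where
  m_pos : 0 < m
  m_le : m ≤ 4
  α_pos : 0 < α
  a_pos : 0 < a
  cont : ContinuousOn f (Ici 0)
  cont₁ : ContinuousOn f₁ (Ici 0)
  cont₂ : ContinuousOn f₂ (Ici 0)
  cont₃ : ContinuousOn f₃ (Ici 0)
  deriv : ∀ y, 0 < y → HasDerivAt f (f₁ y) y
  deriv₁ : ∀ y, 0 < y → HasDerivAt f₁ (f₂ y) y
  deriv₂ : ∀ y, 0 < y → HasDerivAt f₂ (f₃ y) y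
  ode : ∀ y, 0 < y → HasDerivAt (fun s => f s ^ m * f₃ s) (-(α * (f y - y * f₁ y))) y
  init : f 0 = 1
  init₁ : f₁ 0 = 0
  init₃ : f₃ 0 = 0
  growth : Tendsto (fun y => f y / y) atTop (𝓝 a)

lemma IsProfile.profileSystem {m α κ a : ℝ} {f : ℝ → ℝ} (h : IsProfile m α κ a f) (hm : 0 < m)
    (hm4 : m ≤ 4) (hα : 0 < α) :
    ProfileSystem m α a f (profileDeriv 1 f) (profileDeriv 2 f) (profileDeriv 3 f) := by
  have hc : ∀ k : ℕ, k ≤ 3 → ContinuousOn (profileDeriv k f) (Ici 0) := fun k hk =>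
    h.contDiffOn.continuousOn_iteratedDerivWithin (by exact_mod_cast hk) (uniqueDiffOn_Ici 0)
  have hd : ∀ k : ℕ, k < 3 → ∀ y, 0 < y →
      HasDerivAt (profileDeriv k f) (profileDeriv (k + 1) f y) y := by
    intro k hk y hy
    have := (h.contDiffOn.differentiableOn_iteratedDerivWithin (m := k) (by exact_mod_cast hk)
      (uniqueDiffOn_Ici 0) y hy.le).hasDerivWithinAt
    rw [← iteratedDerivWithin_succ] at this
    exact this.hasDerivAt (Ici_mem_nhds hy)
  have h0 : profileDeriv 0 f = f := by
    funext y
    simp [profileDeriv]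
  exact ⟨hm, hm4, hα, h.slope_pos, h.contDiffOn.continuousOn, hc 1 (by norm_num),
    hc 2 (by norm_num), hc 3 (by norm_num), fun y hy => by simpa [h0] using hd 0 (by norm_num) y hy,
    hd 1 (by norm_num), hd 2 (by norm_num), h.ode, h.init_zero, h.init_one, h.init_three,
    h.linear_growth⟩

/-! ### Positivity of the profile -/

namespace ProfileSystem

variable {m α a : ℝ} {f f₁ f₂ f₃ : ℝ → ℝ}

lemma continuousOn_pow (h : ProfileSystem m α a f f₁ f₂ f₃) :
    ContinuousOn (fun y => f y ^ m) (Ici 0) :=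
  h.cont.rpow_const fun _ _ => Or.inr h.m_pos.le

lemma continuousOn_flux (h : ProfileSystem m α a f f₁ f₂ f₃) :
    ContinuousOn (fun y => f y ^ m * f₃ y) (Ici 0) :=
  h.continuousOn_pow.mul h.cont₃

lemma pos (h : ProfileSystem m α a f f₁ f₂ f₃) {y : ℝ} (hy : 0 ≤ y) : 0 < f y := by
  by_contra hneg
  push Not at hneg
  -- the first zero
  have hcy : ContinuousOn f (Icc 0 y) := h.cont.mono Icc_subset_Ici_self
  have hne : (Icc 0 y ∩ f ⁻¹' {0}).Nonempty := by
    obtain ⟨x, hx, hx0⟩ := intermediate_value_Icc' hy hcy (show (0 : ℝ) ∈ Icc (f y) (f 0) from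
      ⟨hneg, by rw [h.init]; exact zero_le_one⟩)
    exact ⟨x, hx, hx0⟩
  have hcl : IsCompact (Icc 0 y ∩ f ⁻¹' {0}) :=
    (isCompact_Icc).of_isClosed_subset
      (hcy.preimage_isClosed_of_isClosed isClosed_Icc isClosed_singleton) inter_subset_left
  obtain ⟨b, ⟨hb, hb0⟩, hmin⟩ := hcl.exists_isLeast hne
  have hb0 : f b = 0 := hb0
  have hbpos : 0 < b := lt_of_le_of_ne hb.1 (by rintro rfl; rw [h.init] at hb0; norm_num at hb0)
  have hpos : ∀ x ∈ Ioo 0 b, 0 < f x := by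
    intro x hx
    by_contra hx0
    push Not at hx0
    obtain ⟨x', hx', hx'0⟩ := intermediate_value_Icc' hx.1.le (h.cont.mono Icc_subset_Ici_self)
      (show (0 : ℝ) ∈ Icc (f x) (f 0) from ⟨hx0, by rw [h.init]; exact zero_le_one⟩)
    have := hmin ⟨⟨hx'.1, hx'.2.trans (hx.2.le.trans hb.2)⟩, hx'0⟩
    linarith [hx'.2, hx.2]
  -- the energy identity up to the first zero
  set B : ℝ → ℝ := fun s => α * (f s * f₁ s - s * f₁ s ^ 2 / 2) + f s ^ m * f₃ s * f₂ s with hB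
  have hBc : ContinuousOn B (Icc 0 b) := by
    have := h.continuousOn_flux.mul h.cont₂
    have := ((h.cont.mul h.cont₁).sub ((continuousOn_id.mul (h.cont₁.pow 2)).div_const 2)).const_smul
      α |>.add this
    exact this.mono Icc_subset_Ici_self
  have hBd : ∀ x ∈ Ioo 0 b, HasDerivAt B (α * f₁ x ^ 2 / 2 + f x ^ m * f₃ x ^ 2) x := by
    intro x hx
    have := ((((h.deriv x hx.1).mul (h.deriv₁ x hx.1)).sub
      (((hasDerivAt_id x).mul ((h.deriv₁ x hx.1).pow 2)).div_const 2)).const_mul α).add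
      ((h.ode x hx.1).mul (h.deriv₂ x hx.1))
    refine this.congr_deriv ?_
    simp only [id, Pi.pow_apply]
    push_cast
    ring
  have hB0 : B 0 = 0 := by simp [hB, h.init₁, h.init₃]
  have hBb : B b ≤ 0 := by
    -- At a zero of `f` the flux term vanishes since `0 ^ m = 0` for `m > 0`. Thus `B` is
    -- nondecreasing with `B 0 = 0` and `B b ≤ 0`, hence identically zero, which makes `f` constant.
    have : B b = -(α * b * f₁ b ^ 2 / 2) := by
      simp only [hB, hb0, Real.zero_rpow h.m_pos.ne']
      ring
    rw [this]
    have := h.α_pos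
    have : 0 ≤ α * b * f₁ b ^ 2 / 2 := by positivity
    linarith
  have hnn : ∀ x ∈ Ioo 0 b, 0 ≤ f x ^ m * f₃ x ^ 2 := fun x hx =>
    mul_nonneg (Real.rpow_nonneg (hpos x hx).le _) (sq_nonneg _)
  have hmono : MonotoneOn B (Icc 0 b) := by
    refine monotoneOn_of_deriv_nonneg (convex_Icc _ _) hBc ?_ ?_
    · rw [interior_Icc]
      exact fun x hx => (hBd x hx).differentiableAt.differentiableWithinAt
    · rw [interior_Icc]
      intro x hx
      rw [(hBd x hx).deriv]
      have := h.α_pos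
      have := hnn x hx
      positivity
  have hBz : ∀ x ∈ Icc 0 b, B x = 0 := fun x hx =>
    le_antisymm ((hmono hx (right_mem_Icc.2 hb.1) hx.2).trans hBb)
      (hB0 ▸ hmono (left_mem_Icc.2 hb.1) hx hx.1)
  have hf₁ : ∀ x ∈ Ioo 0 b, f₁ x = 0 := by
    intro x hx
    have h1 : HasDerivAt B 0 x := (hasDerivAt_const x (0 : ℝ)).congr_of_eventuallyEq (by
      filter_upwards [Ioo_mem_nhds hx.1 hx.2] with s hs
      exact hBz s (Ioo_subset_Icc_self hs))
    have h2 := (hBd x hx).unique h1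
    have h3 := hnn x hx
    have h4 : α * f₁ x ^ 2 / 2 ≤ 0 := by linarith
    have h5 : f₁ x ^ 2 ≤ 0 := by
      have := h.α_pos
      by_contra hc
      push Not at hc
      have : 0 < α * f₁ x ^ 2 / 2 := by positivity
      linarith
    exact pow_eq_zero_iff (two_ne_zero) |>.1 (le_antisymm h5 (sq_nonneg _))
  obtain ⟨x, hx, hxd⟩ := exists_hasDerivAt_eq_slope f f₁ hbpos
    (h.cont.mono Icc_subset_Ici_self) (fun x hx => h.deriv x hx.1)
  rw [hf₁ x hx, hb0, h.init] at hxd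
  have : (0 - 1) / (b - 0) ≠ 0 := div_ne_zero (by norm_num) (by linarith)
  exact this hxd.symm

end ProfileSystem

/-! ### The monotone quantity and first integrability -/

namespace ProfileSystem

variable {m α a : ℝ} {f f₁ f₂ f₃ : ℝ → ℝ}

/-- The derivative of the flux `f ^ m * f'''`, as given by the equation. -/
def fluxDeriv (α : ℝ) (f f₁ : ℝ → ℝ) (y : ℝ) : ℝ := -(α * (f y - y * f₁ y))

lemma continuousOn_fluxDeriv (h : ProfileSystem m α a f f₁ f₂ f₃) :
    ContinuousOn (fluxDeriv α f f₁) (Ici 0) :=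
  ((h.cont.sub (continuousOn_id.mul h.cont₁)).const_smul α).neg

lemma hasDerivAt_fluxDeriv (h : ProfileSystem m α a f f₁ f₂ f₃) {y : ℝ} (hy : 0 < y) :
    HasDerivAt (fluxDeriv α f f₁) (α * y * f₂ y) y := by
  refine ((((h.deriv y hy).sub ((hasDerivAt_id y).mul (h.deriv₁ y hy))).const_mul α).neg).congr_deriv
    ?_
  simp only [id]
  ring

/-- `f''` cannot keep a sign and stay away from zero. -/
lemma not_forall_le_mul_second_deriv (h : ProfileSystem m α a f f₁ f₂ f₃) {s b c : ℝ} (hb : 0 < b)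
    (hc : 0 < c) : ¬ ∀ y, b ≤ y → c ≤ s * f₂ y := by
  intro hs
  have h1 : ∀ y, b ≤ y → s * f₁ b + c * (y - b) ≤ s * f₁ y := fun y hy =>
    linear_lower_bound_of_le_deriv (g := fun y => s * f₁ y) (g' := fun y => s * f₂ y)
      (fun x hx => (h.deriv₁ x (hb.trans_le hx)).const_mul s) hs hy
  -- the slope of `s f` exceeds `s a + 1` eventually
  set d := b + |s * a + 1 - s * f₁ b| / c with hd
  have hbd : b ≤ d := by
    have : 0 ≤ |s * a + 1 - s * f₁ b| / c := by positivity
    linarith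
  have hd0 : 0 < d := by linarith
  have h2 : ∀ y ∈ Ici d, s * a + 1 ≤ s * f₁ y := by
    intro y hy
    have hy : d ≤ y := hy
    have := h1 y (hbd.trans hy)
    have h3 : c * (d - b) = |s * a + 1 - s * f₁ b| := by
      rw [hd]; field_simp; ring
    have h4 := le_abs_self (s * a + 1 - s * f₁ b)
    have h5 : c * (d - b) ≤ c * (y - b) := by gcongr
    linarith
  have h3 : ∀ y, d ≤ y → s * f d + (s * a + 1) * (y - d) ≤ s * f y := fun y hy =>
    linear_lower_bound_of_le_deriv (g := fun y => s * f y) (g' := fun y => s * f₁ y)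
      (fun x hx => (h.deriv x (hd0.trans_le hx)).const_mul s) h2 hy
  have hlim : Tendsto (fun y => s * (f y / y) - (s * f d - (s * a + 1) * d) / y) atTop
      (𝓝 (s * a - 0)) :=
    (h.growth.const_mul s).sub (tendsto_const_nhds.div_atTop tendsto_id)
  have hge : ∀ᶠ y in atTop, s * a + 1 ≤ s * (f y / y) - (s * f d - (s * a + 1) * d) / y := by
    filter_upwards [eventually_ge_atTop d] with y hy
    have hy0 : 0 < y := hd0.trans_le hy
    have := h3 y hy
    have e : s * (f y / y) - (s * f d - (s * a + 1) * d) / y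
        = (s * f y - (s * f d - (s * a + 1) * d)) / y := by ring
    rw [e, le_div_iff₀ hy0]
    linarith
  have := ge_of_tendsto hlim hge
  linarith

/-- A monotone quantity along profiles. -/
noncomputable def monotoneQuantity (m α : ℝ) (f f₁ f₂ f₃ : ℝ → ℝ) (y : ℝ) : ℝ :=
  f y ^ m * f₃ y * f₂ y - fluxDeriv α f f₁ y ^ 2 / (2 * α * y)

/-- The term `z f''` from differentiating `w f''` cancels exactly against the one from `z²/(2αy)`,
because `z' = α y f''`; only squares are left. -/
lemma hasDerivAt_monotoneQuantity (h : ProfileSystem m α a f f₁ f₂ f₃) {y : ℝ} (hy : 0 < y) :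
    HasDerivAt (monotoneQuantity m α f f₁ f₂ f₃)
      (f y ^ m * f₃ y ^ 2 + fluxDeriv α f f₁ y ^ 2 / (2 * α * y ^ 2)) y := by
  have hα := h.α_pos
  have hz := h.hasDerivAt_fluxDeriv hy
  have hw : HasDerivAt (fun s => f s ^ m * f₃ s) (fluxDeriv α f f₁ y) y := h.ode y hy
  refine ((hw.mul (h.deriv₂ y hy)).sub ((hz.pow 2).div ((hasDerivAt_id y).const_mul (2 * α))
    (by simp only [id]; positivity))).congr_deriv ?_
  simp only [id, Pi.pow_apply]
  field_simp
  push_cast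
  ring

lemma deriv_monotoneQuantity_nonneg (h : ProfileSystem m α a f f₁ f₂ f₃) {y : ℝ} (hy : 0 < y) :
    0 ≤ f y ^ m * f₃ y ^ 2 + fluxDeriv α f f₁ y ^ 2 / (2 * α * y ^ 2) := by
  have := h.α_pos
  have := Real.rpow_pos_of_pos (h.pos hy.le) m
  positivity

/-- A positive value persists and forces `f'' f''' > 0` from then on, so `f''` keeps its sign and
moves away from zero, which linear growth of `f` forbids. -/
lemma monotoneQuantity_nonpos (h : ProfileSystem m α a f f₁ f₂ f₃) {b : ℝ} (hb : 0 < b) :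
    monotoneQuantity m α f f₁ f₂ f₃ b ≤ 0 := by
  by_contra hpos
  push Not at hpos
  have hα := h.α_pos
  have hmono : MonotoneOn (monotoneQuantity m α f f₁ f₂ f₃) (Ici b) :=
    monotoneOn_Ici_of_hasDerivAt (fun x hx => h.hasDerivAt_monotoneQuantity (hb.trans_le hx))
      (fun x hx => h.deriv_monotoneQuantity_nonneg (hb.trans_le hx))
  have hprod : ∀ y ∈ Ici b, 0 < f₂ y * f₃ y := by
    intro y hy
    have hy0 : 0 < y := hb.trans_le hy
    have h1 := hmono self_mem_Ici hy hy
    have h2 : 0 ≤ fluxDeriv α f f₁ y ^ 2 / (2 * α * y) := by positivity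
    have h3 : 0 < f y ^ m * (f₂ y * f₃ y) := by
      unfold monotoneQuantity at h1 hpos
      linarith [mul_right_comm (f y ^ m) (f₃ y) (f₂ y), mul_assoc (f y ^ m) (f₂ y) (f₃ y)]
    exact (mul_pos_iff_of_pos_left (Real.rpow_pos_of_pos (h.pos hy0.le) m)).1 h3
  -- `f₂ ^ 2` is increasing, and `f₂` keeps its sign
  have hf2b : f₂ b ≠ 0 := fun h0 => by
    have := hprod b self_mem_Ici
    rw [h0, zero_mul] at this
    exact lt_irrefl _ this
  have hsign : ∀ y ∈ Ici b, 0 < f₂ b * f₂ y := by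
    intro y hy
    by_contra hle
    push Not at hle
    have hc : ContinuousOn (fun s => f₂ b * f₂ s) (Icc b y) :=
      (h.cont₂.mono fun s hs => hb.le.trans hs.1).const_smul (f₂ b)
    obtain ⟨x, hx, hx0⟩ := intermediate_value_Icc' hy hc
      (show (0 : ℝ) ∈ Icc (f₂ b * f₂ y) (f₂ b * f₂ b) from ⟨hle, mul_self_nonneg _⟩)
    rcases mul_eq_zero.1 hx0 with h0 | h0
    · exact hf2b h0
    · have := hprod x hx.1
      rw [h0, zero_mul] at this
      exact lt_irrefl _ this
  have hinc : MonotoneOn (fun y => f₂ b * f₂ y) (Ici b) := by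
    refine monotoneOn_Ici_of_hasDerivAt (g' := fun y => f₂ b * f₃ y)
      (fun x hx => (h.deriv₂ x (hb.trans_le hx)).const_mul _) ?_
    intro x hx
    have h1 := hsign x hx
    have h2 := hprod x hx
    have h3 : 0 < (f₂ b * f₃ x) * (f₂ x * f₂ x) := by nlinarith
    exact (pos_of_mul_pos_left h3 (mul_self_nonneg _)).le
  refine h.not_forall_le_mul_second_deriv hb (c := f₂ b * f₂ b) (s := f₂ b) ?_ ?_
  · exact hsign b self_mem_Ici
  · exact fun y hy => hinc self_mem_Ici hy hy

lemma integrableOn_dissipation_and_fluxDeriv (h : ProfileSystem m α a f f₁ f₂ f₃) {b : ℝ}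
    (hb : 0 < b) :
    IntegrableOn (fun y => f y ^ m * f₃ y ^ 2 + fluxDeriv α f f₁ y ^ 2 / (2 * α * y ^ 2))
      (Ioi b) := by
  have hs : Ici b ⊆ Ici 0 := Ici_subset_Ici.2 hb.le
  have hα := h.α_pos
  refine integrableOn_Ioi_of_le_deriv (C := 0)
    (fun x hx => h.hasDerivAt_monotoneQuantity (hb.trans_le hx)) ?_
    (fun x hx => h.deriv_monotoneQuantity_nonneg (hb.trans_le hx)) (fun x _ => le_rfl)
    (fun x hx => h.monotoneQuantity_nonpos (hb.trans_le hx))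
  refine ((h.continuousOn_pow.mul (h.cont₃.pow 2)).mono hs).add
    (((h.continuousOn_fluxDeriv.pow 2).mono hs).div (by fun_prop) ?_)
  intro x hx
  have : 0 < x := hb.trans_le hx
  positivity

end ProfileSystem

/-! ### A coercive quadratic form -/

/-- The quadratic form governing the weighted energy estimates for profiles. -/
noncomputable def profileForm (m α A θ c e k H σ P U Z : ℝ) : ℝ :=
  H * P ^ 2 + (1 - k) / (2 * α) * Z ^ 2 + θ * A * ((m - 1 + k) * U ^ 2 + 2 * (P * U))
    + k * (H * (P * U)) + c * (Z ^ 2 + α * (H * (P * U)) + (k - 2) * (H * σ * (Z * P)))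
    + e * ((m - 3 + k) * (σ * (U * Z)) + σ * (P * Z) + α * U ^ 2)

/-- At `m = 4` the weight `σ` equals `1`, so cross terms do not fade. For `c = 0` the `P, U` part is
close to `A` times `P² + (2 + k)PU + (3 + k)U²`, which is definite at `k = 0` and `k = 1`; the `Z²`
term degenerates at `k = 1`. A small `c` restores it and lets `k` go slightly beyond `1`. -/
lemma profileForm_coercive_of_eq_four {α A : ℝ} (hα : 0 < α) (hA : 0 < A) :
    ∃ c ε : ℝ, 0 < c ∧ 0 < ε ∧ ∀ k H : ℝ, (k = 0 ∨ k = 1 + α * c) → 99 / 100 * A ≤ H →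
      H ≤ 101 / 100 * A → ∀ P U Z : ℝ,
      ε * (P ^ 2 + U ^ 2 + Z ^ 2) ≤ profileForm 4 α A 1 c 0 k H 1 P U Z := by
  -- Small against both `1/α` and `1/A`, so that every correction carrying `c` costs about one
  -- percent.
  set c : ℝ := 1 / (100 * (α + A)) with hc
  have hc0 : 0 < c := by positivity
  have hcα : α * c ≤ 1 / 100 := by
    rw [hc, mul_one_div, div_le_iff₀ (by positivity)]; linarith
  have hcA : A * c ≤ 1 / 100 := by
    rw [hc, mul_one_div, div_le_iff₀ (by positivity)]; linarith
  refine ⟨c, min (A / 10) (c / 4), hc0, by positivity, ?_⟩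
  intro k H hk h1 h2 P U Z
  have hH : 0 < H := by linarith
  have hε1 : min (A / 10) (c / 4) ≤ A / 10 := min_le_left _ _
  have hε2 : min (A / 10) (c / 4) ≤ c / 4 := min_le_right _ _
  have e1 := mul_le_mul_of_nonneg_right hε1 (sq_nonneg P)
  have e2 := mul_le_mul_of_nonneg_right hε1 (sq_nonneg U)
  have e3 := mul_le_mul_of_nonneg_right hε2 (sq_nonneg Z)
  have hk0 : 0 ≤ k := by
    rcases hk with rfl | rfl
    · exact le_rfl
    · positivity
  have hk1 : k ≤ 101 / 100 := by rcases hk with rfl | rfl <;> linarith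
  -- the coefficient of `Z ^ 2`
  have hZ : c / 2 ≤ (1 - k) / (2 * α) + c := by
    rcases hk with rfl | rfl
    · have : 0 ≤ (1 - 0) / (2 * α) := by positivity
      linarith
    · have : (1 - (1 + α * c)) / (2 * α) = -(c / 2) := by field_simp; ring
      linarith
  have hZ' := mul_le_mul_of_nonneg_right hZ (sq_nonneg Z)
  -- the `Z P` term
  have hZP : -(c / 4 * Z ^ 2 + 41 / 1000 * A * P ^ 2) ≤ c * ((k - 2) * (H * 1 * (Z * P))) := by
    have q1 : -(c / 4 * Z ^ 2 + c * ((2 - k) * H) ^ 2 * P ^ 2)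
        ≤ c * ((k - 2) * (H * 1 * (Z * P))) := by
      nlinarith [mul_nonneg hc0.le (sq_nonneg (Z / 2 - (2 - k) * H * P))]
    have q2 : ((2 - k) * H) ^ 2 ≤ (202 / 100 * A) ^ 2 := by
      have h3 : (2 - k) * H ≤ 2 * (101 / 100 * A) :=
        mul_le_mul (by linarith) h2 hH.le (by norm_num)
      have h4 : 0 ≤ (2 - k) * H := mul_nonneg (by linarith) hH.le
      exact pow_le_pow_left₀ h4 (by linarith) 2
    have q3 : c * ((2 - k) * H) ^ 2 ≤ 41 / 1000 * A := by
      calc c * ((2 - k) * H) ^ 2 ≤ c * (202 / 100 * A) ^ 2 := by gcongr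
        _ = (202 / 100) ^ 2 * (A * c) * A := by ring
        _ ≤ (202 / 100) ^ 2 * (1 / 100) * A := by gcongr
        _ ≤ 41 / 1000 * A := by
          rw [show (202 / 100 : ℝ) ^ 2 * (1 / 100) = 10201 / 250000 by norm_num]
          have : (10201 / 250000 : ℝ) ≤ 41 / 1000 := by norm_num
          gcongr
    have := mul_le_mul_of_nonneg_right q3 (sq_nonneg P)
    linarith
  -- the `P U` term
  set B : ℝ := 2 * A + k * H + c * α * H with hB
  have hB0 : 0 ≤ B := by positivity
  have hcαH : c * α * H ≤ 11 / 1000 * A := by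
    calc c * α * H = α * c * H := by ring
      _ ≤ 1 / 100 * (101 / 100 * A) := by gcongr
      _ ≤ 11 / 1000 * A := by linarith
  -- The unequal weights fit the budget: `B/4 ≤ 0.76 A` stays below the coefficient of `P²`, and `B
  -- ≤ (2.04 + k) A` below the `(3 + k) A` of `U²`.
  have hPU : -(B * (P ^ 2 / 4 + U ^ 2)) ≤ B * (P * U) := by
    nlinarith [mul_nonneg hB0 (sq_nonneg (P / 2 + U))]
  have hBle : B ≤ 304 / 100 * A ∧ B ≤ (2 + k) * A + 4 / 100 * A := by
    have : k * H ≤ k * (101 / 100 * A) := by gcongr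
    have : k * (101 / 100 * A) ≤ 101 / 100 * (101 / 100 * A) := by gcongr
    have : k * A ≤ 101 / 100 * A := by gcongr
    constructor <;> linarith
  have f1 := mul_le_mul_of_nonneg_right hBle.1 (sq_nonneg P)
  have f2 := mul_le_mul_of_nonneg_right hBle.2 (sq_nonneg U)
  have f3 := mul_le_mul_of_nonneg_right h1 (sq_nonneg P)
  have f4 : 0 ≤ A * P ^ 2 := by positivity
  have f5 : 0 ≤ A * U ^ 2 := by positivity
  unfold profileForm
  have key : H * P ^ 2 + (1 - k) / (2 * α) * Z ^ 2 + 1 * A * ((4 - 1 + k) * U ^ 2 + 2 * (P * U))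
    + k * (H * (P * U)) + c * (Z ^ 2 + α * (H * (P * U)) + (k - 2) * (H * 1 * (Z * P)))
    + 0 * ((4 - 3 + k) * (1 * (U * Z)) + 1 * (P * Z) + α * U ^ 2)
    = H * P ^ 2 + ((1 - k) / (2 * α) + c) * Z ^ 2 + B * (P * U) + (3 + k) * A * U ^ 2
      + c * ((k - 2) * (H * 1 * (Z * P))) := by rw [hB]; ring
  rw [key]
  linarith

lemma neg_le_mul_mul_of_abs_le {x y d D : ℝ} (hd : |d| ≤ D) :
    -(D * (x ^ 2 + y ^ 2) / 2) ≤ d * (x * y) := by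
  have a1 : |d * (x * y)| ≤ D * ((x ^ 2 + y ^ 2) / 2) := by
    rw [abs_mul]
    refine mul_le_mul hd ?_ (abs_nonneg _) ((abs_nonneg _).trans hd)
    rw [abs_le]
    constructor <;> nlinarith [sq_nonneg (x + y), sq_nonneg (x - y)]
  have := neg_le_of_abs_le a1
  linarith

lemma cross_terms_lower_bound {m A c e k H : ℝ} (hm : 0 < m) (hm4 : m < 4) (hA : 0 < A)
    (hc : 0 < c) (he : 0 < e) (hk0 : 0 ≤ k) (hk6 : k ≤ 6) (hH : 0 < H) (hHA : H ≤ 2 * A)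
    (P U Z : ℝ) : -((8 * c * A + 8 * e) * (P ^ 2 + U ^ 2 + Z ^ 2)) ≤
      c * (k - 2) * H * (Z * P) + e * (m - 3 + k) * (U * Z) + e * (P * Z) := by
  have d1 : |c * (k - 2) * H| ≤ 8 * c * A := by
    rw [abs_mul, abs_mul, abs_of_pos hc, abs_of_pos hH]
    have : |k - 2| ≤ 4 := abs_le.2 ⟨by linarith, by linarith⟩
    calc c * |k - 2| * H ≤ c * 4 * (2 * A) := by gcongr
      _ = 8 * c * A := by ring
  have d2 : |e * (m - 3 + k)| ≤ 7 * e := by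
    rw [abs_mul, abs_of_pos he]
    have : |m - 3 + k| ≤ 7 := abs_le.2 ⟨by linarith, by linarith⟩
    calc e * |m - 3 + k| ≤ e * 7 := by gcongr
      _ = 7 * e := by ring
  have y1 := neg_le_mul_mul_of_abs_le (x := Z) (y := P) d1
  have y2 := neg_le_mul_mul_of_abs_le (x := U) (y := Z) d2
  have y3 := neg_le_mul_mul_of_abs_le (x := P) (y := Z) (abs_of_pos he).le
  have p1 : 0 ≤ c * A * P ^ 2 := by positivity
  have p2 : 0 ≤ c * A * Z ^ 2 := by positivity
  have p3 : 0 ≤ c * A * U ^ 2 := by positivity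
  have p4 : 0 ≤ e * P ^ 2 := by positivity
  have p5 : 0 ≤ e * Z ^ 2 := by positivity
  have p6 : 0 ≤ e * U ^ 2 := by positivity
  linarith

lemma profileForm_lower_bound {m α A c e k H σ ε : ℝ} (hm : 0 < m) (hm4 : m < 4)
    (hA : 0 < A) (hc : 0 < c) (he : 0 < e) (hk0 : 0 ≤ k) (hk6 : k ≤ 6) (hα : 0 < α)
    (heα : e * α = (6 + c * α) ^ 2 * A + 1) (hZ : 1 ≤ (1 - k) / (2 * α) + c)
    (h1 : A / 2 ≤ H) (h2 : H ≤ 2 * A) (hσ : 0 ≤ σ) (hσG : σ * (8 * c * A + 8 * e) ≤ ε)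
    (hε1 : ε ≤ A / 8) (hε2 : ε ≤ 1 / 2) (P U Z : ℝ) :
    ε * (P ^ 2 + U ^ 2 + Z ^ 2) ≤ profileForm m α A 0 c e k H σ P U Z := by
  have hH : 0 < H := by linarith
  have hZ' := mul_le_mul_of_nonneg_right hZ (sq_nonneg Z)
  have hB0 : 0 ≤ k + c * α := by positivity
  have hBL : (k + c * α) ^ 2 ≤ (6 + c * α) ^ 2 := pow_le_pow_left₀ hB0 (by linarith) 2
  have hPU : -(H / 2 * P ^ 2 + (6 + c * α) ^ 2 * A * U ^ 2) ≤ (k + c * α) * (H * (P * U)) := by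
    have q1 : -(H / 2 * P ^ 2 + (k + c * α) ^ 2 * H / 2 * U ^ 2)
        ≤ (k + c * α) * (H * (P * U)) := by
      nlinarith [mul_nonneg hH.le (sq_nonneg (P + (k + c * α) * U))]
    have q2 : (k + c * α) ^ 2 * H / 2 ≤ (6 + c * α) ^ 2 * A := by
      have : (k + c * α) ^ 2 * H ≤ (6 + c * α) ^ 2 * (2 * A) := by gcongr
      linarith
    have := mul_le_mul_of_nonneg_right q2 (sq_nonneg U)
    linarith
  have hsum := mul_le_mul_of_nonneg_left
    (cross_terms_lower_bound hm hm4 hA hc he hk0 hk6 hH h2 P U Z) hσ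
  have hcross : σ * (8 * c * A + 8 * e) * (P ^ 2 + U ^ 2 + Z ^ 2)
      ≤ ε * (P ^ 2 + U ^ 2 + Z ^ 2) := by gcongr
  have f1 := mul_le_mul_of_nonneg_right h1 (sq_nonneg P)
  have g1 := mul_le_mul_of_nonneg_right hε1 (sq_nonneg P)
  have g2 := mul_le_mul_of_nonneg_right hε2 (sq_nonneg U)
  have g3 := mul_le_mul_of_nonneg_right hε2 (sq_nonneg Z)
  have key : profileForm m α A 0 c e k H σ P U Z
    = H * P ^ 2 + ((1 - k) / (2 * α) + c) * Z ^ 2 + (k + c * α) * (H * (P * U))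
      + ((6 + c * α) ^ 2 * A + 1) * U ^ 2
      + σ * (c * (k - 2) * H * (Z * P) + e * (m - 3 + k) * (U * Z) + e * (P * Z)) := by
    rw [← heα]
    unfold profileForm
    ring
  rw [key]
  linarith

/-- All terms mixing `Z` with `P` or `U` carry a factor `σ`, which may be taken small. So `c` and
`e` can be large: `c` makes `Z²` coercive, `e` supplies enough `U²` to absorb `PU`. -/
lemma profileForm_coercive_of_lt_four {m α A : ℝ} (hm : 0 < m) (hm4 : m < 4) (hα : 0 < α)
    (hA : 0 < A) :
    ∃ c e ε δ : ℝ, 0 < ε ∧ 0 < δ ∧ ∀ k H σ : ℝ, (k = 0 ∨ k = 6) → A / 2 ≤ H → H ≤ 2 * A →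
      0 ≤ σ → σ ≤ δ → ∀ P U Z : ℝ,
      ε * (P ^ 2 + U ^ 2 + Z ^ 2) ≤ profileForm m α A 0 c e k H σ P U Z := by
  -- Chosen so that `(1 - k)/(2α) + c = 1 + (7 - k)/(2α)`, which is at least `1` for all `k ≤ 6`.
  obtain ⟨c, hc⟩ : ∃ c : ℝ, c = 1 + 3 / α := ⟨_, rfl⟩
  have hc0 : 0 < c := by rw [hc]; positivity
  obtain ⟨e, he⟩ : ∃ e : ℝ, e = ((6 + c * α) ^ 2 * A + 1) / α := ⟨_, rfl⟩
  have he0 : 0 < e := by rw [he]; positivity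
  have heα : e * α = (6 + c * α) ^ 2 * A + 1 := by rw [he]; field_simp
  have hG0 : 0 < 8 * c * A + 8 * e := by positivity
  have hε0 : 0 < min (A / 8) (1 / 2) := by positivity
  refine ⟨c, e, min (A / 8) (1 / 2), min (A / 8) (1 / 2) / (8 * c * A + 8 * e), hε0,
    by positivity, ?_⟩
  intro k H σ hk h1 h2 hσ hσδ P U Z
  rw [le_div_iff₀ hG0] at hσδ
  have hk0 : 0 ≤ k ∧ k ≤ 6 := by rcases hk with rfl | rfl <;> norm_num
  have hZ : 1 ≤ (1 - k) / (2 * α) + c := by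
    have : (1 - k) / (2 * α) + c = 1 + (7 - k) / (2 * α) := by rw [hc]; field_simp; ring
    rw [this]
    have : 0 ≤ (7 - k) / (2 * α) := div_nonneg (by linarith) (by linarith)
    linarith
  exact profileForm_lower_bound hm hm4 hA hc0 he0 hk0.1 hk0.2 hα heα hZ h1 h2 hσ hσδ
    (min_le_left _ _) (min_le_right _ _) P U Z

/-! ### Coercivity along the profile at infinity -/

namespace ProfileSystem

variable {m α a : ℝ} {f f₁ f₂ f₃ : ℝ → ℝ}

lemma tendsto_mobility (h : ProfileSystem m α a f f₁ f₂ f₃) :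
    Tendsto (fun y => f y ^ m / y ^ m) atTop (𝓝 (a ^ m)) := by
  refine (h.growth.rpow_const (Or.inl h.a_pos.ne')).congr' ?_
  filter_upwards [eventually_gt_atTop 0] with y hy
  rw [Real.div_rpow (h.pos hy.le).le hy.le]

/-- Coercivity at `k = 0` makes the energy monotone and at `k = K` makes its `y^K` multiple
monotone. The weight of `f''²` is then `y^(K+m-2)`, whose exponent must exceed `3` for `y^β f''`
with `β > 1` to be integrable by Cauchy–Schwarz; for `m = 4` the value `K = 1 + αc` just suffices.
-/
lemma exists_coercive_form (h : ProfileSystem m α a f f₁ f₂ f₃) :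
    ∃ θ c e K ε : ℝ, 0 < ε ∧ 1 ≤ K ∧ 3 < K + m - 2 ∧ ∀ᶠ y : ℝ in atTop, ∀ k, (k = 0 ∨ k = K) →
      ∀ P U Z : ℝ, ε * (P ^ 2 + U ^ 2 + Z ^ 2) ≤
        profileForm m α (a ^ m) θ c e k (f y ^ m / y ^ m) (y ^ (m / 2) / y ^ 2) P U Z := by
  have hA : 0 < a ^ m := Real.rpow_pos_of_pos h.a_pos m
  rcases h.m_le.eq_or_lt with rfl | hm
  · obtain ⟨c, ε, hc, hε, H⟩ := profileForm_coercive_of_eq_four h.α_pos hA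
    have hαc := mul_pos h.α_pos hc
    refine ⟨1, c, 0, 1 + α * c, ε, hε, by linarith, by linarith, ?_⟩
    filter_upwards [h.tendsto_mobility.eventually_const_le
        (show 99 / 100 * a ^ (4 : ℝ) < a ^ (4 : ℝ) by linarith),
      h.tendsto_mobility.eventually_le_const
        (show a ^ (4 : ℝ) < 101 / 100 * a ^ (4 : ℝ) by linarith), eventually_gt_atTop 0]
      with y h1 h2 hy k hk
    have : y ^ ((4 : ℝ) / 2) / y ^ 2 = 1 := by
      rw [show (4 : ℝ) / 2 = ((2 : ℕ) : ℝ) by norm_num, Real.rpow_natCast]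
      exact div_self (by positivity)
    rw [this]
    exact H k _ hk h1 h2
  · obtain ⟨c, e, ε, δ, hε, hδ, H⟩ := profileForm_coercive_of_lt_four h.m_pos hm h.α_pos hA
    refine ⟨0, c, e, 6, ε, hε, by norm_num, by linarith [h.m_pos], ?_⟩
    have hσ : Tendsto (fun y : ℝ => y ^ (m / 2) / y ^ 2) atTop (𝓝 0) := by
      refine (tendsto_rpow_neg_atTop (show 0 < 2 - m / 2 by linarith)).congr' ?_
      filter_upwards [eventually_gt_atTop 0] with y hy
      rw [show -(2 - m / 2) = m / 2 - (2 : ℕ) by push_cast; ring, Real.rpow_sub_natCast hy.ne']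
    filter_upwards [h.tendsto_mobility.eventually_const_le
        (show a ^ m / 2 < a ^ m by linarith),
      h.tendsto_mobility.eventually_le_const
        (show a ^ m < 2 * a ^ m by linarith), eventually_gt_atTop 0,
      hσ.eventually_le_const hδ] with y h1 h2 hy h3 k hk
    exact H k _ _ hk h1 h2 (by positivity) h3

end ProfileSystem

lemma rpow_eq_rpow_half_sq {y : ℝ} (hy : 0 ≤ y) (m : ℝ) : y ^ m = (y ^ (m / 2)) ^ 2 := by
  rw [← Real.rpow_natCast, ← Real.rpow_mul hy]
  congr 1
  push_cast
  ring

lemma hasDerivAt_rpow_div {y : ℝ} (hy : 0 < y) (m : ℝ) :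
    HasDerivAt (fun s : ℝ => s ^ m) (m * y ^ m / y) y := by
  refine (Real.hasDerivAt_rpow_const (Or.inl hy.ne')).congr_deriv ?_
  rw [Real.rpow_sub_one hy.ne']
  ring

/-! ### Scaled variables, energy and weighted integrability -/

namespace ProfileSystem

variable {m α a : ℝ} {f f₁ f₂ f₃ : ℝ → ℝ}

/-- The third derivative in the scaled variables. -/
noncomputable def scaledThird (m : ℝ) (f₃ : ℝ → ℝ) (y : ℝ) : ℝ := y ^ (m / 2) * f₃ y

/-- The second derivative in the scaled variables. -/
noncomputable def scaledSecond (m : ℝ) (f₂ : ℝ → ℝ) (y : ℝ) : ℝ := y ^ (m / 2) * f₂ y / y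

/-- The derivative of the flux in the scaled variables. -/
noncomputable def scaledFluxDeriv (α : ℝ) (f f₁ : ℝ → ℝ) (y : ℝ) : ℝ := fluxDeriv α f f₁ y / y

/-- The squared norm of the scaled variables. -/
noncomputable def scaledNormSq (m α : ℝ) (f f₁ f₂ f₃ : ℝ → ℝ) (y : ℝ) : ℝ :=
  scaledThird m f₃ y ^ 2 + scaledSecond m f₂ y ^ 2 + scaledFluxDeriv α f f₁ y ^ 2

/-- An energy whose derivative is the quadratic form `profileForm` in the scaled variables. -/
noncomputable def scaledEnergy (m α a θ c e : ℝ) (f f₁ f₂ f₃ : ℝ → ℝ) (y : ℝ) : ℝ :=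
  monotoneQuantity m α f f₁ f₂ f₃ y + θ * a ^ m * (y ^ m * f₂ y ^ 2 / y)
    + c * (f y ^ m * f₃ y * fluxDeriv α f f₁ y / y ^ 2)
    + e * (y ^ m * (f₂ y * fluxDeriv α f f₁ y) / y ^ 3)

lemma scaledNormSq_nonneg (y : ℝ) : 0 ≤ scaledNormSq m α f f₁ f₂ f₃ y := by
  unfold scaledNormSq
  positivity

lemma continuousOn_scaledNormSq (h : ProfileSystem m α a f f₁ f₂ f₃) {b : ℝ} (hb : 0 < b) :
    ContinuousOn (scaledNormSq m α f f₁ f₂ f₃) (Ici b) := by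
  have hs : Ici b ⊆ Ici 0 := Ici_subset_Ici.2 hb.le
  have hne : ∀ x ∈ Ici b, x ≠ 0 := fun x hx => (hb.trans_le hx).ne'
  have hr : ContinuousOn (fun y : ℝ => y ^ (m / 2)) (Ici b) :=
    continuousOn_id.rpow_const fun x hx => Or.inl (hne x hx)
  exact (((hr.mul (h.cont₃.mono hs)).pow 2).add
    (((hr.mul (h.cont₂.mono hs)).div continuousOn_id hne).pow 2)).add
    (((h.continuousOn_fluxDeriv.mono hs).div continuousOn_id hne).pow 2)

lemma deriv_monotoneQuantity_eq (h : ProfileSystem m α a f f₁ f₂ f₃) {y : ℝ} (hy : 0 < y) :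
    f y ^ m * f₃ y ^ 2 + fluxDeriv α f f₁ y ^ 2 / (2 * α * y ^ 2)
      = f y ^ m / y ^ m * scaledThird m f₃ y ^ 2 + 1 / (2 * α) * scaledFluxDeriv α f f₁ y ^ 2 := by
  have hα := h.α_pos
  have hr : 0 < y ^ (m / 2) := Real.rpow_pos_of_pos hy _
  simp only [scaledThird, scaledFluxDeriv, rpow_eq_rpow_half_sq hy.le m]
  field_simp

lemma hasDerivAt_weighted_second_mul_fluxDeriv (h : ProfileSystem m α a f f₁ f₂ f₃) {y : ℝ}
    (hy : 0 < y) :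
    HasDerivAt (fun s => s ^ m * (f₂ s * fluxDeriv α f f₁ s) / s ^ 3)
      ((m - 3) * (y ^ (m / 2) / y ^ 2 * (scaledSecond m f₂ y * scaledFluxDeriv α f f₁ y))
        + y ^ (m / 2) / y ^ 2 * (scaledThird m f₃ y * scaledFluxDeriv α f f₁ y)
        + α * scaledSecond m f₂ y ^ 2) y := by
  refine (((hasDerivAt_rpow_div hy m).mul ((h.deriv₂ y hy).mul (h.hasDerivAt_fluxDeriv hy))).div
    (hasDerivAt_pow 3 y) (by positivity)).congr_deriv ?_
  simp only [scaledThird, scaledSecond, scaledFluxDeriv, rpow_eq_rpow_half_sq hy.le m, Pi.mul_apply]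
  have hr : 0 < y ^ (m / 2) := Real.rpow_pos_of_pos hy _
  field_simp
  push_cast
  ring

lemma hasDerivAt_weighted_second_sq (h : ProfileSystem m α a f f₁ f₂ f₃) {y : ℝ} (hy : 0 < y) :
    HasDerivAt (fun s => s ^ m * f₂ s ^ 2 / s)
      ((m - 1) * scaledSecond m f₂ y ^ 2 + 2 * (scaledThird m f₃ y * scaledSecond m f₂ y)) y := by
  refine (((hasDerivAt_rpow_div hy m).mul ((h.deriv₂ y hy).pow 2)).div
    (hasDerivAt_id y) hy.ne').congr_deriv ?_
  simp only [scaledThird, scaledSecond, rpow_eq_rpow_half_sq hy.le m, Pi.mul_apply, Pi.pow_apply, id]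
  have hr : 0 < y ^ (m / 2) := Real.rpow_pos_of_pos hy _
  field_simp
  push_cast
  ring

lemma hasDerivAt_flux_mul_fluxDeriv (h : ProfileSystem m α a f f₁ f₂ f₃) {y : ℝ} (hy : 0 < y) :
    HasDerivAt (fun s => f s ^ m * f₃ s * fluxDeriv α f f₁ s / s ^ 2)
      (scaledFluxDeriv α f f₁ y ^ 2
        + α * (f y ^ m / y ^ m * (scaledThird m f₃ y * scaledSecond m f₂ y))
        - 2 * (f y ^ m / y ^ m * (y ^ (m / 2) / y ^ 2)
          * (scaledFluxDeriv α f f₁ y * scaledThird m f₃ y))) y := by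
  have hw : HasDerivAt (fun s => f s ^ m * f₃ s) (fluxDeriv α f f₁ y) y := h.ode y hy
  refine ((hw.mul (h.hasDerivAt_fluxDeriv hy)).div (hasDerivAt_pow 2 y)
    (by positivity)).congr_deriv ?_
  simp only [scaledThird, scaledSecond, scaledFluxDeriv, rpow_eq_rpow_half_sq hy.le m, Pi.mul_apply]
  have hr : 0 < y ^ (m / 2) := Real.rpow_pos_of_pos hy _
  field_simp
  push_cast
  ring

lemma hasDerivAt_scaledEnergy (h : ProfileSystem m α a f f₁ f₂ f₃) (θ c e : ℝ) {y : ℝ}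
    (hy : 0 < y) :
    HasDerivAt (scaledEnergy m α a θ c e f f₁ f₂ f₃)
      (profileForm m α (a ^ m) θ c e 0 (f y ^ m / y ^ m) (y ^ (m / 2) / y ^ 2)
        (scaledThird m f₃ y) (scaledSecond m f₂ y) (scaledFluxDeriv α f f₁ y)) y := by
  refine ((((h.hasDerivAt_monotoneQuantity hy).add
    ((h.hasDerivAt_weighted_second_sq hy).const_mul (θ * a ^ m))).add
    ((h.hasDerivAt_flux_mul_fluxDeriv hy).const_mul c)).add
    ((h.hasDerivAt_weighted_second_mul_fluxDeriv hy).const_mul e)).congr_deriv ?_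
  rw [h.deriv_monotoneQuantity_eq hy]
  unfold profileForm
  ring

lemma scaledEnergy_div (h : ProfileSystem m α a f f₁ f₂ f₃) (θ c e : ℝ) {y : ℝ} (hy : 0 < y) :
    scaledEnergy m α a θ c e f f₁ f₂ f₃ y / y =
      f y ^ m / y ^ m * (scaledThird m f₃ y * scaledSecond m f₂ y)
        - 1 / (2 * α) * scaledFluxDeriv α f f₁ y ^ 2 + θ * a ^ m * scaledSecond m f₂ y ^ 2
        + c * (f y ^ m / y ^ m * (y ^ (m / 2) / y ^ 2)
          * (scaledFluxDeriv α f f₁ y * scaledThird m f₃ y))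
        + e * (y ^ (m / 2) / y ^ 2 * (scaledSecond m f₂ y * scaledFluxDeriv α f f₁ y)) := by
  have hα := h.α_pos
  have hr : 0 < y ^ (m / 2) := Real.rpow_pos_of_pos hy _
  simp only [scaledEnergy, monotoneQuantity, scaledThird, scaledSecond, scaledFluxDeriv,
    rpow_eq_rpow_half_sq hy.le m]
  field_simp

/-- Identifies the parameter `k` as the exponent of a power weight: `(y^k R)' = y^k (R' + k R/y)`.
-/
lemma profileForm_eq_add (h : ProfileSystem m α a f f₁ f₂ f₃) (θ c e k : ℝ) {y : ℝ} (hy : 0 < y) :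
    profileForm m α (a ^ m) θ c e k (f y ^ m / y ^ m) (y ^ (m / 2) / y ^ 2)
        (scaledThird m f₃ y) (scaledSecond m f₂ y) (scaledFluxDeriv α f f₁ y)
      = profileForm m α (a ^ m) θ c e 0 (f y ^ m / y ^ m) (y ^ (m / 2) / y ^ 2)
        (scaledThird m f₃ y) (scaledSecond m f₂ y) (scaledFluxDeriv α f f₁ y)
        + k * (scaledEnergy m α a θ c e f f₁ f₂ f₃ y / y) := by
  rw [h.scaledEnergy_div θ c e hy]
  unfold profileForm
  ring

lemma rpow_half_div_sq_le_one (h : ProfileSystem m α a f f₁ f₂ f₃) {y : ℝ} (hy : 1 ≤ y) :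
    y ^ (m / 2) / y ^ 2 ≤ 1 := by
  rw [div_le_one (by positivity), ← Real.rpow_natCast]
  exact Real.rpow_le_rpow_of_exponent_le hy (by push_cast; linarith [h.m_le])

lemma exists_mobility_bounds (h : ProfileSystem m α a f f₁ f₂ f₃) :
    ∀ᶠ y in atTop, a ^ m / 2 ≤ f y ^ m / y ^ m ∧ f y ^ m / y ^ m ≤ 2 * a ^ m := by
  have hA : 0 < a ^ m := Real.rpow_pos_of_pos h.a_pos m
  filter_upwards [h.tendsto_mobility.eventually_const_le (show a ^ m / 2 < a ^ m by linarith),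
    h.tendsto_mobility.eventually_le_const (show a ^ m < 2 * a ^ m by linarith)] with y h1 h2
  exact ⟨h1, h2⟩

/-- The scaled variables are square integrable. -/
lemma exists_integrableOn_scaledNormSq (h : ProfileSystem m α a f f₁ f₂ f₃) :
    ∃ b, 0 < b ∧ IntegrableOn (scaledNormSq m α f f₁ f₂ f₃) (Ioi b) := by
  have hα := h.α_pos
  have hA : 0 < a ^ m := Real.rpow_pos_of_pos h.a_pos m
  obtain ⟨b, hbb⟩ := eventually_atTop.1 (h.exists_mobility_bounds.and (eventually_ge_atTop 1))
  have hb1 : 1 ≤ b := (hbb b le_rfl).2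
  have hb0 : 0 < b := by linarith
  refine ⟨b, hb0, ?_⟩
  have hQi := h.integrableOn_dissipation_and_fluxDeriv hb0
  -- The two summands produce `P²/2` and `(9/α + 1/2) Z²` from the lower bound on `Q'`. These absorb
  -- `σPZ` and, since `3|UZ| ≤ (α/4) U² + (9/α) Z²`, also `(m - 3)σUZ`.
  obtain ⟨C, hC⟩ : ∃ C : ℝ, C = 1 / a ^ m + 2 * α * (9 / α + 1 / 2) := ⟨_, rfl⟩
  have hC0 : 0 < C := by rw [hC]; positivity
  set N : ℝ → ℝ := scaledNormSq m α f f₁ f₂ f₃ with hN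
  set S : ℝ → ℝ := fun s => s ^ m * (f₂ s * fluxDeriv α f f₁ s) / s ^ 3 with hS
  set Q' : ℝ → ℝ := fun y => f y ^ m * f₃ y ^ 2 + fluxDeriv α f f₁ y ^ 2 / (2 * α * y ^ 2) with hQ'
  set G' : ℝ → ℝ := fun y =>
    ((m - 3) * (y ^ (m / 2) / y ^ 2 * (scaledSecond m f₂ y * scaledFluxDeriv α f f₁ y))
        + y ^ (m / 2) / y ^ 2 * (scaledThird m f₃ y * scaledFluxDeriv α f f₁ y)
        + α * scaledSecond m f₂ y ^ 2) + C * Q' y with hG'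
  have hQ'lower : ∀ y ∈ Ici b, a ^ m / 2 * scaledThird m f₃ y ^ 2
      + 1 / (2 * α) * scaledFluxDeriv α f f₁ y ^ 2 ≤ Q' y := by
    intro y hy
    rw [hQ']
    simp only
    rw [h.deriv_monotoneQuantity_eq (hb0.trans_le hy)]
    have := (hbb y hy).1.1
    gcongr
  have hder : ∀ y ∈ Ici b,
      HasDerivAt (fun s => S s + C * monotoneQuantity m α f f₁ f₂ f₃ s) (G' y) y := fun y hy =>
    (h.hasDerivAt_weighted_second_mul_fluxDeriv (hb0.trans_le hy)).add
      ((h.hasDerivAt_monotoneQuantity (hb0.trans_le hy)).const_mul C)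
  have hlow : ∀ y ∈ Ici b, α / 2 * scaledSecond m f₂ y ^ 2 ≤ G' y := by
    intro y hy
    have hσ1 := h.rpow_half_div_sq_le_one (hb1.trans hy)
    have hσ0 : 0 ≤ y ^ (m / 2) / y ^ 2 :=
      div_nonneg (Real.rpow_nonneg (hb0.le.trans hy) _) (sq_nonneg _)
    have hq := mul_le_mul_of_nonneg_left (hQ'lower y hy) hC0.le
    simp only [hG']
    generalize scaledSecond m f₂ y = U at *
    generalize scaledThird m f₃ y = P at *
    generalize scaledFluxDeriv α f f₁ y = Z at *
    generalize y ^ (m / 2) / y ^ 2 = σ at *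
    have e1 : P ^ 2 / 2 + (9 / α + 1 / 2) * Z ^ 2
        ≤ C * (a ^ m / 2 * P ^ 2 + 1 / (2 * α) * Z ^ 2) := by
      have : C * (a ^ m / 2 * P ^ 2 + 1 / (2 * α) * Z ^ 2) =
          P ^ 2 / 2 + (9 / α + 1 / 2) * Z ^ 2 + (2 * α * (9 / α + 1 / 2) * (a ^ m / 2) * P ^ 2
            + 1 / a ^ m * (1 / (2 * α)) * Z ^ 2) := by
        rw [hC]; field_simp; ring
      rw [this]
      have : 0 ≤ 2 * α * (9 / α + 1 / 2) * (a ^ m / 2) * P ^ 2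
            + 1 / a ^ m * (1 / (2 * α)) * Z ^ 2 := by positivity
      linarith
    have e2 : -(α / 4 * U ^ 2 + 9 / α * Z ^ 2) ≤ (m - 3) * (σ * (U * Z)) := by
      have t1 : |(m - 3) * σ| ≤ 3 := by
        rw [abs_mul, abs_of_nonneg hσ0]
        have : |m - 3| ≤ 3 := abs_le.2 ⟨by linarith [h.m_pos], by linarith [h.m_le]⟩
        calc |m - 3| * σ ≤ 3 * 1 := by gcongr
          _ = 3 := by norm_num
      have t2 : |(m - 3) * (σ * (U * Z))| ≤ 3 * |U * Z| := by
        rw [← mul_assoc, abs_mul]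
        gcongr
      have t3 : 3 * |U * Z| ≤ α / 4 * U ^ 2 + 9 / α * Z ^ 2 := by
        have : α / 4 * U ^ 2 + 9 / α * Z ^ 2 - 3 * |U * Z|
            = α / 4 * (|U| - 6 / α * |Z|) ^ 2 := by
          rw [abs_mul, ← sq_abs U, ← sq_abs Z]
          field_simp
          ring
        have : 0 ≤ α / 4 * (|U| - 6 / α * |Z|) ^ 2 := by positivity
        linarith
      exact neg_le_of_abs_le (t2.trans t3)
    have e3 : -(P ^ 2 / 2 + 1 / 2 * Z ^ 2) ≤ σ * (P * Z) := by
      have := neg_le_mul_mul_of_abs_le (x := P) (y := Z) (d := σ) (D := 1)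
        (by rwa [abs_of_nonneg hσ0])
      linarith
    have e4 : 0 ≤ α / 4 * U ^ 2 := by positivity
    linarith
  have hcontN := h.continuousOn_scaledNormSq hb0
  have hcontU : ContinuousOn (fun y => α / 2 * scaledSecond m f₂ y ^ 2) (Ici b) := by
    have hne : ∀ x ∈ Ici b, x ≠ 0 := fun x hx => (hb0.trans_le hx).ne'
    exact ((((continuousOn_id.rpow_const fun x hx => Or.inl (hne x hx)).mul
      (h.cont₂.mono (Ici_subset_Ici.2 hb0.le))).div continuousOn_id hne).pow 2).const_smul (α / 2)
  have hQi' : IntegrableOn Q' (Ioi b) := hQi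
  have hZle : ∀ y ∈ Ici b, scaledFluxDeriv α f f₁ y ^ 2 ≤ 2 * α * Q' y := by
    intro y hy
    have h1 := hQ'lower y hy
    have h2 : 0 ≤ a ^ m / 2 * scaledThird m f₃ y ^ 2 := by positivity
    have h3 : 1 / (2 * α) * scaledFluxDeriv α f f₁ y ^ 2 ≤ Q' y := by linarith
    calc scaledFluxDeriv α f f₁ y ^ 2
        = 2 * α * (1 / (2 * α) * scaledFluxDeriv α f f₁ y ^ 2) := by field_simp
      _ ≤ 2 * α * Q' y := by gcongr
  -- the auxiliary quantity is bounded
  have hbdd : ∀ y ∈ Ici b, S y + C * monotoneQuantity m α f f₁ f₂ f₃ y ≤ 1 := by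
    by_contra hcon
    push Not at hcon
    obtain ⟨d, hd, hd1⟩ := hcon
    have hd : b ≤ d := hd
    have hd0 : 0 < d := by linarith
    have hmono := monotoneOn_Ici_of_hasDerivAt hder
      (fun y hy => le_trans (by positivity) (hlow y hy))
    have hS1 : ∀ y ∈ Ici d, 1 ≤ S y := by
      intro y hy
      have h1 := hmono hd (hd.trans hy) hy
      have h2 := h.monotoneQuantity_nonpos (hd0.trans_le hy)
      have h3 : C * monotoneQuantity m α f f₁ f₂ f₃ y ≤ 0 :=
        mul_nonpos_of_nonneg_of_nonpos hC0.le h2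
      simp only at h1
      linarith
    -- From `S ≥ 1` and `m ≤ 4` follows `y f'' z ≥ 1`, so `(z²)' ≥ 2α`. Linear growth of `z²` would
    -- give `Z² ≥ α/y` far out, against integrability of `Z²`.
    have hz2 : ∀ y, d ≤ y → fluxDeriv α f f₁ d ^ 2 + 2 * α * (y - d) ≤ fluxDeriv α f f₁ y ^ 2 := by
      intro y hy
      refine linear_lower_bound_of_le_deriv (g := fun s => fluxDeriv α f f₁ s ^ 2)
        (g' := fun s => 2 * fluxDeriv α f f₁ s * (α * s * f₂ s)) ?_ ?_ hy
      · intro x hx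
        exact ((h.hasDerivAt_fluxDeriv (hd0.trans_le hx)).pow 2).congr_deriv (by push_cast; ring)
      · intro x hx
        have hx0 : 0 < x := hd0.trans_le hx
        have hx1 : 1 ≤ x := (hb1.trans hd).trans hx
        have h1 := hS1 x hx
        simp only [hS] at h1
        rw [one_le_div (by positivity)] at h1
        have h2 : x ^ m ≤ x ^ 4 := by
          rw [← Real.rpow_natCast]
          exact Real.rpow_le_rpow_of_exponent_le hx1 (by push_cast; exact h.m_le)
        have hxm : 0 < x ^ m := Real.rpow_pos_of_pos hx0 m
        have h3 : 0 < f₂ x * fluxDeriv α f f₁ x := by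
          have : 0 < x ^ m * (f₂ x * fluxDeriv α f f₁ x) := lt_of_lt_of_le (by positivity) h1
          exact (mul_pos_iff_of_pos_left hxm).1 this
        have h4 : x ^ 3 * 1 ≤ x ^ 3 * (x * (f₂ x * fluxDeriv α f f₁ x)) := by
          have : x ^ m * (f₂ x * fluxDeriv α f f₁ x) ≤ x ^ 4 * (f₂ x * fluxDeriv α f f₁ x) := by
            gcongr
          calc x ^ 3 * 1 = x ^ 3 := mul_one _
            _ ≤ x ^ 4 * (f₂ x * fluxDeriv α f f₁ x) := h1.trans this
            _ = _ := by ring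
        have h5 := le_of_mul_le_mul_left h4 (by positivity)
        calc 2 * α = 2 * α * 1 := (mul_one _).symm
          _ ≤ 2 * α * (x * (f₂ x * fluxDeriv α f f₁ x)) := by gcongr
          _ = _ := by ring
    refine not_integrableOn_Ioi_of_div_le (b := 2 * d) (c := α) (a := b) hα ?_ (hQi'.const_mul (2 * α))
    intro y hy
    have hdy : d ≤ y := by linarith
    have hy0 : 0 < y := by linarith
    refine le_trans ?_ (hZle y (hd.trans hdy))
    have h1 := hz2 y hdy
    have h2 : α * y ≤ fluxDeriv α f f₁ y ^ 2 := by
      have := sq_nonneg (fluxDeriv α f f₁ d)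
      have : α * (2 * d) ≤ α * y := by gcongr
      linarith
    rw [scaledFluxDeriv, div_pow, div_le_div_iff₀ hy0 (by positivity)]
    calc α * y ^ 2 = (α * y) * y := by ring
      _ ≤ _ := by gcongr
  have hUi : IntegrableOn (fun y => α / 2 * scaledSecond m f₂ y ^ 2) (Ioi b) :=
    integrableOn_Ioi_of_le_deriv hder hcontU (fun y _ => by positivity) hlow hbdd
  refine Integrable.mono' ((hQi'.const_mul (2 / a ^ m + 2 * α)).add (hUi.const_mul (2 / α)))
    ((hcontN.mono Ioi_subset_Ici_self).aestronglyMeasurable measurableSet_Ioi) ?_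
  filter_upwards [ae_restrict_mem measurableSet_Ioi] with y hy
  have hy : y ∈ Ici b := Ioi_subset_Ici_self hy
  rw [Real.norm_of_nonneg (scaledNormSq_nonneg y)]
  have h1 := hZle y hy
  have h2 : scaledThird m f₃ y ^ 2 ≤ 2 / a ^ m * Q' y := by
    have h1 := hQ'lower y hy
    have h2 : 0 ≤ 1 / (2 * α) * scaledFluxDeriv α f f₁ y ^ 2 := by positivity
    calc scaledThird m f₃ y ^ 2 = 2 / a ^ m * (a ^ m / 2 * scaledThird m f₃ y ^ 2) := by field_simp
      _ ≤ 2 / a ^ m * Q' y := by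
        have : a ^ m / 2 * scaledThird m f₃ y ^ 2 ≤ Q' y := by linarith
        gcongr
  have h3 : 2 / α * (α / 2 * scaledSecond m f₂ y ^ 2) = scaledSecond m f₂ y ^ 2 := by field_simp
  simp only [scaledNormSq, Pi.add_apply]
  rw [h3]
  linarith

/-- Algebraic decay: the scaled variables are square integrable with a weight. -/
lemma exists_integrableOn_rpow_mul_scaledNormSq (h : ProfileSystem m α a f f₁ f₂ f₃) :
    ∃ b K, 1 ≤ b ∧ 1 ≤ K ∧ 3 < K + m - 2 ∧
      IntegrableOn (fun y => y ^ K * scaledNormSq m α f f₁ f₂ f₃ y) (Ioi b) := by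
  have hα := h.α_pos
  have hA : 0 < a ^ m := Real.rpow_pos_of_pos h.a_pos m
  obtain ⟨θ, c, e, K, ε, hε, hK1, hK3, hev⟩ := h.exists_coercive_form
  obtain ⟨b₀, hb₀, hNi⟩ := h.exists_integrableOn_scaledNormSq
  obtain ⟨b, hbb⟩ := eventually_atTop.1
    ((h.exists_mobility_bounds.and (eventually_ge_atTop 1)).and
      ((eventually_ge_atTop b₀).and hev))
  have hb1 : 1 ≤ b := (hbb b le_rfl).1.2
  have hb0 : 0 < b := by linarith
  refine ⟨b, K, hb1, hK1, hK3, ?_⟩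
  set N : ℝ → ℝ := scaledNormSq m α f f₁ f₂ f₃ with hN
  set R : ℝ → ℝ := scaledEnergy m α a θ c e f f₁ f₂ f₃ with hR
  have hN0 : ∀ y, 0 ≤ N y := scaledNormSq_nonneg
  obtain ⟨F, hF⟩ : ∃ F : ℝ → ℝ → ℝ, F = fun k y =>
    profileForm m α (a ^ m) θ c e k (f y ^ m / y ^ m) (y ^ (m / 2) / y ^ 2)
        (scaledThird m f₃ y) (scaledSecond m f₂ y) (scaledFluxDeriv α f f₁ y) := ⟨_, rfl⟩
  have hF0 : ∀ y ∈ Ici b, ε * N y ≤ F 0 y := fun y hy => by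
    rw [hF]; exact (hbb y hy).2.2 0 (Or.inl rfl) _ _ _
  have hFK : ∀ y ∈ Ici b, ε * N y ≤ F K y := fun y hy => by
    rw [hF]; exact (hbb y hy).2.2 K (Or.inr rfl) _ _ _
  have hRd : ∀ y ∈ Ici b, HasDerivAt R (F 0 y) y := fun y hy => by
    rw [hF]; exact h.hasDerivAt_scaledEnergy θ c e (hb0.trans_le hy)
  have hFadd : ∀ y ∈ Ici b, F K y = F 0 y + K * (R y / y) := fun y hy => by
    rw [hF]; exact h.profileForm_eq_add θ c e K (hb0.trans_le hy)
  -- upper bound for the energy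
  set D : ℝ := 2 * a ^ m + |θ| * a ^ m + 2 * |c| * a ^ m + |e| with hD
  have hD0 : 0 < D := by positivity
  have hRle : ∀ y ∈ Ici b, R y / y ≤ D * N y := by
    intro y hy
    have hσ1 := h.rpow_half_div_sq_le_one (hb1.trans hy)
    have hσ0 : 0 ≤ y ^ (m / 2) / y ^ 2 :=
      div_nonneg (Real.rpow_nonneg (hb0.le.trans hy) _) (sq_nonneg _)
    obtain ⟨hH1, hH2⟩ := (hbb y hy).1.1
    rw [hR, h.scaledEnergy_div θ c e (hb0.trans_le hy), hN, scaledNormSq]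
    generalize scaledSecond m f₂ y = U at *
    generalize scaledThird m f₃ y = P at *
    generalize scaledFluxDeriv α f f₁ y = Z at *
    generalize y ^ (m / 2) / y ^ 2 = σ at *
    generalize f y ^ m / y ^ m = H at *
    have hH0 : 0 < H := by linarith
    have young : ∀ x y d D : ℝ, |d| ≤ D → d * (x * y) ≤ D * (x ^ 2 + y ^ 2) / 2 := by
      intro x y d D hd
      have := neg_le_mul_mul_of_abs_le (x := x) (y := y) (d := -d) (D := D) (by rwa [abs_neg])
      linarith
    have i1 := young P U H (2 * a ^ m) (by rwa [abs_of_pos hH0])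
    have i2 := young Z P (c * (H * σ)) (2 * |c| * a ^ m) (by
      rw [abs_mul, abs_of_nonneg (by positivity : 0 ≤ H * σ)]
      calc |c| * (H * σ) ≤ |c| * (2 * a ^ m * 1) := by gcongr
        _ = _ := by ring)
    have i3 := young U Z (e * σ) |e| (by
      rw [abs_mul, abs_of_nonneg hσ0]
      calc |e| * σ ≤ |e| * 1 := by gcongr
        _ = _ := by ring)
    have i4 : θ * a ^ m * U ^ 2 ≤ |θ| * a ^ m * U ^ 2 := by
      gcongr
      exact le_abs_self θ
    have i5 : 0 ≤ 1 / (2 * α) * Z ^ 2 := by positivity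
    have p1 : 0 ≤ a ^ m * P ^ 2 := by positivity
    have p2 : 0 ≤ a ^ m * U ^ 2 := by positivity
    have p3 : 0 ≤ a ^ m * Z ^ 2 := by positivity
    have p4 : 0 ≤ |θ| * a ^ m * P ^ 2 := by positivity
    have p6 : 0 ≤ |θ| * a ^ m * Z ^ 2 := by positivity
    have p7 : 0 ≤ |c| * a ^ m * P ^ 2 := by positivity
    have p8 : 0 ≤ |c| * a ^ m * U ^ 2 := by positivity
    have p9 : 0 ≤ |c| * a ^ m * Z ^ 2 := by positivity
    have p10 : 0 ≤ |e| * P ^ 2 := by positivity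
    have p11 : 0 ≤ |e| * U ^ 2 := by positivity
    have p12 : 0 ≤ |e| * Z ^ 2 := by positivity
    rw [hD]
    linarith
  -- the energy is nonpositive
  have hRnp : ∀ y ∈ Ici b, R y ≤ 0 := by
    by_contra hcon
    push Not at hcon
    obtain ⟨d, hd, hd1⟩ := hcon
    have hmono := monotoneOn_Ici_of_hasDerivAt hRd
      (fun y hy => le_trans (mul_nonneg hε.le (hN0 y)) (hF0 y hy))
    -- A positive energy value persists by monotonicity, so `P² + U² + Z² ≥ R(d)/(D y)`, which is
    -- not integrable.
    refine not_integrableOn_Ioi_of_div_le (b := d) (c := R d / D) (a := b₀) (by positivity) ?_ hNi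
    intro y hy
    have hyb : y ∈ Ici b := hd.trans hy
    have hy0 : 0 < y := hb0.trans_le hyb
    have h1 : R d / y ≤ D * N y := by
      refine le_trans ?_ (hRle y hyb)
      have := hmono hd hyb hy
      gcongr
    rw [div_right_comm, div_le_iff₀ hD0]
    linarith
  have hcont : ContinuousOn (fun y => ε * (y ^ K * N y)) (Ici b) :=
    ((continuousOn_id.rpow_const fun x hx => Or.inl (hb0.trans_le hx).ne').mul
      (h.continuousOn_scaledNormSq hb0)).const_smul ε
  have hi := integrableOn_Ioi_of_le_deriv (g := fun y => y ^ K * R y)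
    (g' := fun y => y ^ K * F K y) (C := 0) (a := b) ?_ hcont ?_ ?_ ?_
  · refine (hi.const_mul ε⁻¹).congr ?_
    filter_upwards with y
    field_simp
  · intro y hy
    have hy0 : 0 < y := hb0.trans_le hy
    refine ((hasDerivAt_rpow_div hy0 K).mul (hRd y hy)).congr_deriv ?_
    rw [hFadd y hy]
    field_simp
    ring
  · intro y hy
    have := Real.rpow_nonneg (hb0.le.trans hy) K
    have := hN0 y
    positivity
  · intro y hy
    have h1 := Real.rpow_nonneg (hb0.le.trans hy) K
    have h2 := mul_le_mul_of_nonneg_left (hFK y hy) h1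
    linarith
  · intro y hy
    exact mul_nonpos_of_nonneg_of_nonpos (Real.rpow_nonneg (hb0.le.trans hy) K) (hRnp y hy)

end ProfileSystem

/-! ### Convergence of the profile to the cone -/

namespace ProfileSystem

variable {m α a : ℝ} {f f₁ f₂ f₃ : ℝ → ℝ}

/-- Weighted integrability of the second derivative, and decay of the derivative of the flux. -/
lemma exists_integrableOn_rpow_mul_second (h : ProfileSystem m α a f f₁ f₂ f₃) :
    ∃ b β : ℝ, 1 ≤ b ∧ 1 < β ∧ IntegrableOn (fun y => y ^ β * |f₂ y|) (Ioi b) ∧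
      Tendsto (fluxDeriv α f f₁) atTop (𝓝 0) := by
  obtain ⟨b, K, hb1, hK1, hK3, hi⟩ := h.exists_integrableOn_rpow_mul_scaledNormSq
  have hb0 : 0 < b := by linarith
  have hα := h.α_pos
  obtain ⟨q, hq⟩ : ∃ q, q = K + m - 2 := ⟨_, rfl⟩
  -- Since `q > 3`, this `β` satisfies both `β > 1` and `2β - q = (1 - q)/2 < -1`, so the remainder
  -- `y^(2β-q)` is integrable.
  obtain ⟨β, hβ⟩ : ∃ β, β = (q + 1) / 4 := ⟨_, rfl⟩
  have hβ1 : 1 < β := by rw [hβ]; linarith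
  have hs : Ici b ⊆ Ici 0 := Ici_subset_Ici.2 hb0.le
  have hcr : ∀ p : ℝ, ContinuousOn (fun y : ℝ => y ^ p) (Ici b) := fun p =>
    continuousOn_id.rpow_const fun x hx => Or.inl (hb0.trans_le hx).ne'
  have hint : IntegrableOn (fun y => y ^ β * |f₂ y|) (Ioi b) := by
    have hi2 : IntegrableOn (fun y : ℝ => y ^ (2 * β - q)) (Ioi b) :=
      integrableOn_Ioi_rpow_of_lt (by rw [hβ]; linarith) hb0
    refine Integrable.mono' (hi.add hi2)
      ((((hcr β).mul (h.cont₂.mono hs).abs).mono Ioi_subset_Ici_self).aestronglyMeasurable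
        measurableSet_Ioi) ?_
    filter_upwards [ae_restrict_mem measurableSet_Ioi] with y hy
    have hy0 : 0 < y := hb0.trans hy
    have hyβ : 0 < y ^ β := Real.rpow_pos_of_pos hy0 _
    rw [Real.norm_of_nonneg (by positivity), Pi.add_apply]
    have h1 : y ^ q * f₂ y ^ 2 ≤ y ^ K * scaledNormSq m α f f₁ f₂ f₃ y := by
      have : y ^ q * f₂ y ^ 2 = y ^ K * scaledSecond m f₂ y ^ 2 := by
        rw [hq, scaledSecond, div_pow, mul_pow, ← rpow_eq_rpow_half_sq hy0.le,
          show K + m - 2 = K + m - (2 : ℕ) by norm_num, Real.rpow_sub_natCast hy0.ne',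
          Real.rpow_add hy0]
        ring
      rw [this]
      have := Real.rpow_pos_of_pos hy0 K
      gcongr
      unfold scaledNormSq
      have := sq_nonneg (scaledThird m f₃ y)
      have := sq_nonneg (scaledFluxDeriv α f f₁ y)
      linarith
    have h2 : y ^ β * |f₂ y| ≤ y ^ q * f₂ y ^ 2 + y ^ (2 * β - q) := by
      set A := y ^ (q / 2) * |f₂ y| with hA
      set B := y ^ (β - q / 2) with hB
      have e1 : y ^ β * |f₂ y| = A * B := by
        rw [hA, hB, mul_right_comm, ← Real.rpow_add hy0]
        congr 2
        ring
      have e2 : y ^ q * f₂ y ^ 2 = A ^ 2 := by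
        rw [hA, mul_pow, sq_abs, ← rpow_eq_rpow_half_sq hy0.le]
      have e3 : y ^ (2 * β - q) = B ^ 2 := by
        rw [hB, rpow_eq_rpow_half_sq hy0.le]
        congr 2
        ring
      rw [e1, e2, e3]
      nlinarith [sq_nonneg (A - B), sq_nonneg A, sq_nonneg B]
    exact h2.trans (by gcongr)
  refine ⟨b, β, hb1, hβ1, hint, ?_⟩
  have hzi : IntegrableOn (fun y => α * y * f₂ y) (Ioi b) := by
    refine Integrable.mono' (hint.const_mul α)
      ((((continuousOn_const.mul continuousOn_id).mul
        (h.cont₂.mono hs)).mono Ioi_subset_Ici_self).aestronglyMeasurable measurableSet_Ioi) ?_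
    filter_upwards [ae_restrict_mem measurableSet_Ioi] with y hy
    have hy1 : 1 ≤ y := hb1.trans (le_of_lt hy)
    have hy0 : 0 < y := hb0.trans hy
    have : y ≤ y ^ β := Real.self_le_rpow_of_one_le hy1 hβ1.le
    rw [Real.norm_eq_abs, abs_mul, abs_mul, abs_of_pos hα, abs_of_pos hy0, mul_assoc]
    gcongr
  have hlim := tendsto_limUnder_of_hasDerivAt_of_integrableOn_Ioi
    (fun y hy => h.hasDerivAt_fluxDeriv (hb0.trans hy)) hzi
  generalize limUnder atTop (fluxDeriv α f f₁) = l at hlim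
  suffices l = 0 by rwa [this] at hlim
  -- The limit of `z` exists because `z' = α y f''` is integrable. If it were nonzero, `y^K Z² ≥
  -- l²/(2y)` would contradict the weighted bound, as `K ≥ 1`.
  by_contra hl
  have hl2 : 0 < l ^ 2 := by positivity
  obtain ⟨d, hd⟩ := eventually_atTop.1 (((hlim.pow 2).eventually_const_le
    (show l ^ 2 / 2 < l ^ 2 by linarith)).and (eventually_ge_atTop 1))
  refine not_integrableOn_Ioi_of_div_le (b := d) (c := l ^ 2 / 2) (by positivity) ?_ hi
  intro y hy
  obtain ⟨h1, hy1⟩ := hd y hy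
  have hy0 : 0 < y := by linarith
  calc l ^ 2 / 2 / y = y * (l ^ 2 / 2 / y ^ 2) := by field_simp
    _ ≤ y ^ K * (fluxDeriv α f f₁ y ^ 2 / y ^ 2) := by
      have : y ≤ y ^ K := Real.self_le_rpow_of_one_le hy1 hK1
      gcongr
    _ ≤ y ^ K * scaledNormSq m α f f₁ f₂ f₃ y := by
      gcongr
      unfold scaledNormSq
      have := sq_nonneg (scaledThird m f₃ y)
      have := sq_nonneg (scaledSecond m f₂ y)
      rw [scaledFluxDeriv, div_pow]
      linarith

lemma eq_add_fluxDeriv (h : ProfileSystem m α a f f₁ f₂ f₃) (y : ℝ) :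
    f y = y * f₁ y - fluxDeriv α f f₁ y / α := by
  have := h.α_pos
  rw [fluxDeriv]
  field_simp
  ring

lemma tendsto_fluxDeriv (h : ProfileSystem m α a f f₁ f₂ f₃) :
    Tendsto (fluxDeriv α f f₁) atTop (𝓝 0) := by
  obtain ⟨-, -, -, -, -, h⟩ := h.exists_integrableOn_rpow_mul_second
  exact h

lemma tendsto_first (h : ProfileSystem m α a f f₁ f₂ f₃) : Tendsto f₁ atTop (𝓝 a) := by
  have h1 : Tendsto (fun y => f y / y + fluxDeriv α f f₁ y / α / y) atTop (𝓝 (a + 0)) :=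
    h.growth.add ((h.tendsto_fluxDeriv.div_const α).div_atTop tendsto_id)
  rw [add_zero] at h1
  refine h1.congr' ?_
  filter_upwards [eventually_gt_atTop 0] with y hy
  rw [h.eq_add_fluxDeriv y]
  field_simp
  ring

/-- The slope converges at an integrable rate. -/
lemma exists_abs_first_sub_le (h : ProfileSystem m α a f f₁ f₂ f₃) :
    ∃ b β C : ℝ, 1 ≤ b ∧ 1 < β ∧ ∀ y, b ≤ y → |f₁ y - a| ≤ C * y ^ (-β) := by
  obtain ⟨b, β, hb1, hβ, hi, -⟩ := h.exists_integrableOn_rpow_mul_second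
  have hb0 : 0 < b := by linarith
  refine ⟨b, β, ∫ s in Ioi b, s ^ β * |f₂ s|, hb1, hβ, ?_⟩
  intro y hy
  have hy0 : 0 < y := by linarith
  have hiy : IntegrableOn (fun s => s ^ β * |f₂ s|) (Ioi y) := hi.mono_set (Ioi_subset_Ioi hy)
  have hle : ∀ s ∈ Ioi y, |f₂ s| ≤ y ^ (-β) * (s ^ β * |f₂ s|) := by
    intro s hs
    have hs : y < s := hs
    have h1 : 1 ≤ y ^ (-β) * s ^ β := by
      rw [Real.rpow_neg hy0.le, ← div_eq_inv_mul, one_le_div (Real.rpow_pos_of_pos hy0 _)]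
      exact Real.rpow_le_rpow hy0.le hs.le (by linarith)
    calc |f₂ s| = 1 * |f₂ s| := (one_mul _).symm
      _ ≤ y ^ (-β) * s ^ β * |f₂ s| := by gcongr
      _ = _ := by ring
  have hi2 : IntegrableOn f₂ (Ioi y) := by
    refine Integrable.mono' (hiy.const_mul (y ^ (-β)))
      ((h.cont₂.mono fun s hs => (hy0.trans hs).le).aestronglyMeasurable measurableSet_Ioi) ?_
    filter_upwards [ae_restrict_mem measurableSet_Ioi] with s hs
    exact hle s hs
  have heq := integral_Ioi_of_hasDerivAt_of_tendsto
    (h.deriv₁ y hy0).continuousAt.continuousWithinAt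
    (fun s hs => h.deriv₁ s (hy0.trans hs)) hi2 h.tendsto_first
  rw [abs_sub_comm, ← heq]
  calc |∫ s in Ioi y, f₂ s| ≤ ∫ s in Ioi y, |f₂ s| := abs_integral_le_integral_abs
    _ ≤ ∫ s in Ioi y, y ^ (-β) * (s ^ β * |f₂ s|) :=
      setIntegral_mono_on hi2.abs (hiy.const_mul _) measurableSet_Ioi hle
    _ = y ^ (-β) * ∫ s in Ioi y, s ^ β * |f₂ s| := integral_const_mul _ _
    _ ≤ y ^ (-β) * ∫ s in Ioi b, s ^ β * |f₂ s| := by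
      have := Real.rpow_pos_of_pos hy0 (-β)
      refine mul_le_mul_of_nonneg_left ?_ this.le
      refine setIntegral_mono_set hi ?_ (Ioi_subset_Ioi hy).eventuallyLE
      filter_upwards [ae_restrict_mem measurableSet_Ioi] with s hs
      exact mul_nonneg (Real.rpow_nonneg (hb0.trans hs).le _) (abs_nonneg _)
    _ = _ := mul_comm _ _

/-- By the equation `f - ay = y(f' - a) - z/α`, and the first term is `O(y^(1-β))` with `β > 1`. -/
lemma tendsto_sub_linear (h : ProfileSystem m α a f f₁ f₂ f₃) :
    Tendsto (fun y => f y - a * y) atTop (𝓝 0) := by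
  obtain ⟨b, β, C, hb1, hβ, hC⟩ := h.exists_abs_first_sub_le
  have h1 : Tendsto (fun y => y * (f₁ y - a)) atTop (𝓝 0) := by
    have hlim : Tendsto (fun y : ℝ => C * y ^ (-(β - 1))) atTop (𝓝 (C * 0)) :=
      (tendsto_rpow_neg_atTop (by linarith)).const_mul C
    rw [mul_zero] at hlim
    refine squeeze_zero_norm' ?_ hlim
    filter_upwards [eventually_ge_atTop b] with y hy
    have hy0 : 0 < y := by linarith
    rw [Real.norm_eq_abs, abs_mul, abs_of_pos hy0]
    calc y * |f₁ y - a| ≤ y * (C * y ^ (-β)) := by gcongr; exact hC y hy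
      _ = C * y ^ (-(β - 1)) := by
        rw [neg_sub, sub_eq_add_neg, Real.rpow_add hy0, Real.rpow_one]
        ring
  have h2 := h1.sub (h.tendsto_fluxDeriv.div_const α)
  rw [zero_div, sub_zero] at h2
  refine h2.congr fun y => ?_
  rw [h.eq_add_fluxDeriv y]
  ring

lemma integrableOn_Ioi_zero_of_continuousOn {ψ : ℝ → ℝ} {b : ℝ} (hb : 0 ≤ b)
    (hc : ContinuousOn ψ (Ici 0)) (hi : IntegrableOn ψ (Ioi b)) : IntegrableOn ψ (Ioi 0) := by
  rw [← Ioc_union_Ioi_eq_Ioi hb]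
  exact ((hc.mono Icc_subset_Ici_self).integrableOn_Icc.mono_set Ioc_subset_Icc_self).union hi

lemma integrableOn_first_sq_sub (h : ProfileSystem m α a f f₁ f₂ f₃) :
    IntegrableOn (fun y => f₁ y ^ 2 - a ^ 2) (Ioi 0) := by
  obtain ⟨b, β, C, hb1, hβ, hC⟩ := h.exists_abs_first_sub_le
  have hcont : ContinuousOn (fun y => f₁ y ^ 2 - a ^ 2) (Ici 0) :=
    (h.cont₁.pow 2).sub continuousOn_const
  have hb0 : 0 < b := by linarith
  have ha := h.a_pos
  refine integrableOn_Ioi_zero_of_continuousOn hb0.le hcont ?_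
  have hC0 : 0 ≤ C := by
    have h1 := (abs_nonneg _).trans (hC b le_rfl)
    exact nonneg_of_mul_nonneg_left h1 (Real.rpow_pos_of_pos hb0 _)
  refine Integrable.mono' ((integrableOn_Ioi_rpow_of_lt (show -β < -1 by linarith) hb0).const_mul
    (C * (C + 2 * a))) ((hcont.mono fun s hs => (hb0.trans hs).le).aestronglyMeasurable
      measurableSet_Ioi) ?_
  filter_upwards [ae_restrict_mem measurableSet_Ioi] with y hy
  have hy1 : 1 ≤ y := hb1.trans (le_of_lt hy)
  have hy0 : 0 < y := by linarith
  have h1 := hC y (le_of_lt hy)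
  have h2 : y ^ (-β) ≤ 1 := Real.rpow_le_one_of_one_le_of_nonpos hy1 (by linarith)
  have h3 : |f₁ y + a| ≤ C + 2 * a := by
    calc |f₁ y + a| = |(f₁ y - a) + 2 * a| := by ring_nf
      _ ≤ |f₁ y - a| + |2 * a| := abs_add_le _ _
      _ ≤ C * 1 + 2 * a := by
        rw [abs_of_pos (by positivity : 0 < 2 * a)]
        have : C * y ^ (-β) ≤ C * 1 := by gcongr
        linarith
      _ = _ := by ring
  have hyβ := Real.rpow_pos_of_pos hy0 (-β)
  rw [Real.norm_eq_abs]
  calc |f₁ y ^ 2 - a ^ 2| = |f₁ y - a| * |f₁ y + a| := by rw [← abs_mul]; congr 1; ring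
    _ ≤ C * y ^ (-β) * (C + 2 * a) := by gcongr
    _ = _ := by ring

/-! ### Dissipation and the energy gap -/

lemma continuousOn_dissipation (h : ProfileSystem m α a f f₁ f₂ f₃) :
    ContinuousOn (fun y => f y ^ m * f₃ y ^ 2) (Ici 0) :=
  h.continuousOn_pow.mul (h.cont₃.pow 2)

lemma dissipation_nonneg (h : ProfileSystem m α a f f₁ f₂ f₃) {y : ℝ} (hy : 0 ≤ y) :
    0 ≤ f y ^ m * f₃ y ^ 2 :=
  mul_nonneg (Real.rpow_nonneg (h.pos hy).le _) (sq_nonneg _)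

lemma integrableOn_dissipation (h : ProfileSystem m α a f f₁ f₂ f₃) :
    IntegrableOn (fun y => f y ^ m * f₃ y ^ 2) (Ioi 0) := by
  refine integrableOn_Ioi_zero_of_continuousOn zero_le_one h.continuousOn_dissipation ?_
  have hα := h.α_pos
  have hi := h.integrableOn_dissipation_and_fluxDeriv (zero_lt_one' ℝ)
  have hc : ContinuousOn (fun y => f y ^ m * f₃ y ^ 2) (Ioi 1) :=
    h.continuousOn_dissipation.mono fun s hs => (zero_lt_one' ℝ).le.trans (le_of_lt hs)
  refine Integrable.mono' hi (hc.aestronglyMeasurable measurableSet_Ioi) ?_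
  filter_upwards [ae_restrict_mem measurableSet_Ioi] with y hy
  have hy0 : 0 < y := (zero_lt_one' ℝ).trans hy
  rw [Real.norm_of_nonneg (h.dissipation_nonneg hy0.le)]
  have : 0 ≤ fluxDeriv α f f₁ y ^ 2 / (2 * α * y ^ 2) := by positivity
  linarith

/-- If the dissipation vanished on `(0,1)`, the flux and hence `z` would vanish there; but `z(0) =
-α` by continuity. -/
lemma intervalIntegral_dissipation_pos (h : ProfileSystem m α a f f₁ f₂ f₃) :
    0 < ∫ y in (0 : ℝ)..1, f y ^ m * f₃ y ^ 2 := by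
  refine intervalIntegral.integral_pos one_pos (h.continuousOn_dissipation.mono Icc_subset_Ici_self)
    (fun y hy => h.dissipation_nonneg hy.1.le) ?_
  by_contra hcon
  push Not at hcon
  have hα := h.α_pos
  have h3 : ∀ y ∈ Ioo (0 : ℝ) 1, f₃ y = 0 := by
    intro y hy
    have h1 := hcon y (Ioo_subset_Icc_self hy)
    by_contra h3
    have := Real.rpow_pos_of_pos (h.pos hy.1.le) m
    have : 0 < f y ^ m * f₃ y ^ 2 := by positivity
    linarith
  have hz : ∀ y ∈ Ioo (0 : ℝ) 1, fluxDeriv α f f₁ y = 0 := by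
    intro y hy
    have h1 : HasDerivAt (fun s => f s ^ m * f₃ s) 0 y :=
      (hasDerivAt_const y (0 : ℝ)).congr_of_eventuallyEq (by
        filter_upwards [Ioo_mem_nhds hy.1 hy.2] with s hs
        rw [h3 s hs, mul_zero])
    exact (h.ode y hy.1).unique h1
  have hz0 : fluxDeriv α f f₁ 0 = 0 := by
    have hc : Tendsto (fluxDeriv α f f₁) (𝓝[>] 0) (𝓝 (fluxDeriv α f f₁ 0)) :=
      (h.continuousOn_fluxDeriv 0 self_mem_Ici).mono Ioi_subset_Ici_self
    refine tendsto_nhds_unique (hc.congr' ?_) tendsto_const_nhds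
    filter_upwards [Ioo_mem_nhdsGT (zero_lt_one' ℝ)] with y hy using hz y hy
  simp only [fluxDeriv, h.init, h.init₁] at hz0
  norm_num at hz0
  exact hα.ne' hz0

lemma integral_dissipation_pos (h : ProfileSystem m α a f f₁ f₂ f₃) :
    0 < ∫ y in Ioi 0, f y ^ m * f₃ y ^ 2 := by
  refine h.intervalIntegral_dissipation_pos.trans_le ?_
  rw [intervalIntegral.integral_of_le zero_le_one]
  refine setIntegral_mono_set h.integrableOn_dissipation ?_ Ioc_subset_Ioi_self.eventuallyLE
  filter_upwards [ae_restrict_mem measurableSet_Ioi] with s hs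
  exact h.dissipation_nonneg (le_of_lt hs)

/-- The profile has less surface energy than the cone. -/
lemma integral_first_sq_sub_neg (h : ProfileSystem m α a f f₁ f₂ f₃) :
    ∫ y in Ioi 0, (f₁ y ^ 2 - a ^ 2) < 0 := by
  have hα := h.α_pos
  have hlim := (intervalIntegral_tendsto_integral_Ioi 0 h.integrableOn_first_sq_sub
    tendsto_id).const_mul (α / 2)
  set D := ∫ y in (0 : ℝ)..1, f y ^ m * f₃ y ^ 2 with hD
  have hDpos : 0 < D := h.intervalIntegral_dissipation_pos
  have hlim2 : Tendsto (fun y => α * ((f y - a * y) * f₁ y)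
      + fluxDeriv α f f₁ y ^ 2 / (2 * α * y) - D) atTop (𝓝 (α * (0 * a) + 0 - D)) := by
    refine Tendsto.sub_const (((h.tendsto_sub_linear.mul h.tendsto_first).const_mul α).add ?_) D
    refine (h.tendsto_fluxDeriv.pow 2).div_atTop ?_
    exact tendsto_id.const_mul_atTop (by positivity)
  have hle : ∀ᶠ Y in atTop, α / 2 * ∫ y in (0 : ℝ)..id Y, (f₁ y ^ 2 - a ^ 2) ≤
      α * ((f Y - a * Y) * f₁ Y) + fluxDeriv α f f₁ Y ^ 2 / (2 * α * Y) - D := by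
    filter_upwards [eventually_ge_atTop 1] with Y hY
    have hY0 : 0 < Y := by linarith
    have hsub : Icc 0 Y ⊆ Ici (0 : ℝ) := Icc_subset_Ici_self
    set B : ℝ → ℝ := fun s => α * (f s * f₁ s - s * f₁ s ^ 2 / 2) + f s ^ m * f₃ s * f₂ s
      - α / 2 * a ^ 2 * s with hB
    have hBc : ContinuousOn B (Icc 0 Y) := by
      have h1 := ((h.cont.mul h.cont₁).sub
        ((continuousOn_id.mul (h.cont₁.pow 2)).div_const 2)).const_smul α
      exact ((h1.add (h.continuousOn_flux.mul h.cont₂)).sub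
        (continuousOn_const.mul continuousOn_id)).mono hsub
    have hBd : ∀ x ∈ Ioo 0 Y,
        HasDerivAt B (α / 2 * (f₁ x ^ 2 - a ^ 2) + f x ^ m * f₃ x ^ 2) x := by
      intro x hx
      refine ((((((h.deriv x hx.1).mul (h.deriv₁ x hx.1)).sub
        (((hasDerivAt_id x).mul ((h.deriv₁ x hx.1).pow 2)).div_const 2)).const_mul α).add
        ((h.ode x hx.1).mul (h.deriv₂ x hx.1))).sub
        ((hasDerivAt_id x).const_mul (α / 2 * a ^ 2))).congr_deriv ?_
      simp only [id, Pi.pow_apply]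
      push_cast
      ring
    have hi1 : IntervalIntegrable (fun y => α / 2 * (f₁ y ^ 2 - a ^ 2)) volume 0 Y :=
      ContinuousOn.intervalIntegrable_of_Icc hY0.le
        (((((h.cont₁.pow 2).sub continuousOn_const).const_smul (α / 2))).mono hsub)
    have hi2 : IntervalIntegrable (fun y => f y ^ m * f₃ y ^ 2) volume 0 Y :=
      ContinuousOn.intervalIntegrable_of_Icc hY0.le (h.continuousOn_dissipation.mono hsub)
    have hFTC := intervalIntegral.integral_eq_sub_of_hasDerivAt_of_le hY0.le hBc hBd (hi1.add hi2)
    rw [intervalIntegral.integral_add hi1 hi2, intervalIntegral.integral_const_mul] at hFTC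
    have hB0 : B 0 = 0 := by simp [hB, h.init₁, h.init₃]
    have hDle : D ≤ ∫ y in (0 : ℝ)..Y, f y ^ m * f₃ y ^ 2 := by
      rw [hD]
      refine intervalIntegral.integral_mono_interval le_rfl zero_le_one hY ?_ hi2
      filter_upwards [ae_restrict_mem measurableSet_Ioc] with s hs
      exact h.dissipation_nonneg hs.1.le
    have hBY : B Y ≤ α * ((f Y - a * Y) * f₁ Y) + fluxDeriv α f f₁ Y ^ 2 / (2 * α * Y) := by
      have hQ := h.monotoneQuantity_nonpos hY0
      unfold monotoneQuantity at hQ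
      -- Completing the square around the slope `a` leaves the discarded term `-αY(f' - a)²/2`,
      -- which has the favourable sign. The sign of `monotoneQuantity` then bounds `w f''` by
      -- `z²/(2αY)`.
      have e : B Y = α * ((f Y - a * Y) * f₁ Y) - α * Y / 2 * (f₁ Y - a) ^ 2
          + f Y ^ m * f₃ Y * f₂ Y := by
        simp only [hB]
        ring
      have : 0 ≤ α * Y / 2 * (f₁ Y - a) ^ 2 := by positivity
      linarith
    simp only [id]
    linarith
  have := le_of_tendsto_of_tendsto hlim hlim2 hle
  have h2 : α / 2 * (∫ y in Ioi 0, (f₁ y ^ 2 - a ^ 2)) < 0 := by linarith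
  exact neg_of_mul_neg_right h2 (by positivity)

end ProfileSystem

/-! ### Self-similar solutions -/

lemma integrable_comp_abs_div {ψ : ℝ → ℝ} (hψ : IntegrableOn ψ (Ioi 0)) {T : ℝ} (hT : 0 < T) :
    Integrable fun x => ψ (|x| / T) := by
  have h1 : IntegrableOn (fun x => ψ |x|) (Ioi 0) :=
    hψ.congr_fun (fun x hx => by rw [abs_of_pos hx]) measurableSet_Ioi
  have h2 : IntegrableOn (fun x => ψ |x|) (Iic 0) := by
    rw [← Measure.map_neg_eq_self (volume : Measure ℝ)]
    let m : MeasurableEmbedding fun x : ℝ => -x := (Homeomorph.neg ℝ).measurableEmbedding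
    rw [m.integrableOn_map_iff]
    simp_rw [Function.comp_def, abs_neg, neg_preimage, neg_Iic, neg_zero]
    exact (Iff.mpr integrableOn_Ici_iff_integrableOn_Ioi h1)
  have h3 : Integrable fun x => ψ |x| := by
    rw [← integrableOn_univ, ← Iic_union_Ioi (a := (0 : ℝ))]
    exact h2.union h1
  refine (h3.comp_div hT.ne').congr (Eventually.of_forall fun x => ?_)
  simp only [abs_div, abs_of_pos hT]

lemma integral_comp_abs_div (ψ : ℝ → ℝ) {T : ℝ} (hT : 0 < T) :
    ∫ x, ψ (|x| / T) = T * (2 * ∫ y in Ioi 0, ψ y) := by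
  have : ∀ x : ℝ, ψ (|x| / T) = (fun z => ψ |z|) (x / T) := fun x => by
    simp only [abs_div, abs_of_pos hT]
  simp_rw [this]
  rw [Measure.integral_comp_div (fun z => ψ |z|) T, integral_comp_abs, abs_of_pos hT, smul_eq_mul]

/-- The sign is locally constant off the origin. Stating equality near `x`, with a free constant
`c`, gives the right side the same form and allows iteration up to the third derivative. -/
lemma deriv_comp_abs_div_eventuallyEq {g g' : ℝ → ℝ} (hg : ∀ y, 0 < y → HasDerivAt g (g' y) y)
    {T : ℝ} (hT : 0 < T) (c : ℝ) {x : ℝ} (hx : x ≠ 0) :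
    deriv (fun z => c * g (|z| / T)) =ᶠ[𝓝 x]
      fun z => c * (SignType.sign x : ℝ) / T * g' (|z| / T) := by
  have hs : ∀ᶠ z in 𝓝 x, SignType.sign z = SignType.sign x ∧ z ≠ 0 := by
    rcases lt_or_gt_of_ne hx with h | h
    · filter_upwards [Iio_mem_nhds h] with z hz
      exact ⟨by rw [sign_neg hz, sign_neg h], ne_of_lt hz⟩
    · filter_upwards [Ioi_mem_nhds h] with z hz
      exact ⟨by rw [sign_pos hz, sign_pos h], ne_of_gt hz⟩
  filter_upwards [hs] with z hz
  have h1 := ((hg (|z| / T) (div_pos (abs_pos.2 hz.2) hT)).comp z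
    ((hasDerivAt_abs hz.2).div_const T)).const_mul c
  rw [hz.1] at h1
  refine h1.deriv.trans ?_
  ring

lemma sign_sq_eq_one {x : ℝ} (hx : x ≠ 0) : (SignType.sign x : ℝ) ^ 2 = 1 := by
  rcases lt_or_gt_of_ne hx with h | h
  · simp [sign_neg h]
  · simp [sign_pos h]

lemma ae_ne_zero : ∀ᵐ x : ℝ, x ≠ 0 := Measure.ae_ne volume 0

lemma deriv_cone_sq (a : ℝ) {x : ℝ} (hx : x ≠ 0) : deriv (cone a) x ^ 2 = a ^ 2 := by
  have : HasDerivAt (cone a) (a * SignType.sign x) x := (hasDerivAt_abs hx).const_mul a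
  rw [this.deriv, mul_pow, sign_sq_eq_one hx, mul_one]

namespace ProfileSystem

variable {m α a : ℝ} {f f₁ f₂ f₃ : ℝ → ℝ}

lemma deriv_selfSimilar_sq (h : ProfileSystem m α a f f₁ f₂ f₃) {T : ℝ} (hT : 0 < T) {x : ℝ}
    (hx : x ≠ 0) : _root_.deriv (fun z => T * f (|z| / T)) x ^ 2 = f₁ (|x| / T) ^ 2 := by
  rw [(deriv_comp_abs_div_eventuallyEq h.deriv hT T hx).eq_of_nhds]
  rw [mul_div_right_comm, div_self hT.ne', one_mul, mul_pow, sign_sq_eq_one hx, one_mul]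

lemma iteratedDeriv_three_selfSimilar_sq (h : ProfileSystem m α a f f₁ f₂ f₃) {T : ℝ} (hT : 0 < T)
    {x : ℝ} (hx : x ≠ 0) :
    iteratedDeriv 3 (fun z => T * f (|z| / T)) x ^ 2 = f₃ (|x| / T) ^ 2 / T ^ 4 := by
  have e1 := deriv_comp_abs_div_eventuallyEq h.deriv hT T hx
  have e2 := e1.deriv.trans (deriv_comp_abs_div_eventuallyEq h.deriv₁ hT _ hx)
  have e3 := e2.deriv.trans (deriv_comp_abs_div_eventuallyEq h.deriv₂ hT _ hx)
  rw [iteratedDeriv_succ, iteratedDeriv_succ, iteratedDeriv_one, e3.eq_of_nhds]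
  have hs := sign_sq_eq_one hx
  have : (T * (SignType.sign x : ℝ) / T * (SignType.sign x : ℝ) / T * (SignType.sign x : ℝ) / T
      * f₃ (|x| / T)) ^ 2 = ((SignType.sign x : ℝ) ^ 2) ^ 3 * (f₃ (|x| / T) ^ 2 / T ^ 4) := by
    field_simp
  rw [this, hs]
  ring

lemma energyDensityChange_ae_eq (h : ProfileSystem m α a f f₁ f₂ f₃) {H : ℝ → ℝ → ℝ} {t T : ℝ}
    (hT : 0 < T) (hH : ∀ z, H z t = T * f (|z| / T)) :
    energyDensityChange H (cone a) t =ᵐ[volume] fun x => f₁ (|x| / T) ^ 2 - a ^ 2 := by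
  filter_upwards [ae_ne_zero] with x hx
  rw [energyDensityChange, deriv_cone_sq a hx, funext hH, h.deriv_selfSimilar_sq hT hx]

lemma integrable_energyDensityChange (h : ProfileSystem m α a f f₁ f₂ f₃) {H : ℝ → ℝ → ℝ} {t T : ℝ}
    (hT : 0 < T) (hH : ∀ z, H z t = T * f (|z| / T)) :
    Integrable (energyDensityChange H (cone a) t) :=
  (integrable_comp_abs_div h.integrableOn_first_sq_sub hT).congr
    (h.energyDensityChange_ae_eq hT hH).symm

lemma half_integral_energyDensityChange (h : ProfileSystem m α a f f₁ f₂ f₃) {H : ℝ → ℝ → ℝ}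
    {t T : ℝ} (hT : 0 < T) (hH : ∀ z, H z t = T * f (|z| / T)) :
    1 / 2 * ∫ x, energyDensityChange H (cone a) t x
      = T * ∫ y in Ioi 0, (f₁ y ^ 2 - a ^ 2) := by
  rw [integral_congr_ae (h.energyDensityChange_ae_eq hT hH),
    integral_comp_abs_div (fun y => f₁ y ^ 2 - a ^ 2) hT]
  ring

/-- The power of `T` collects `T^m` from `h^m`, `T^(-4)` from `h_xxx²` and `T` from the change of
variables. -/
lemma dissipationRate_eq (h : ProfileSystem m α a f f₁ f₂ f₃) {H : ℝ → ℝ → ℝ} {t T : ℝ}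
    (hT : 0 < T) (hH : ∀ z, H z t = T * f (|z| / T)) :
    dissipationRate m H t
      = ENNReal.ofReal (2 * (∫ y in Ioi 0, f y ^ m * f₃ y ^ 2) * T ^ (m - 3)) := by
  have hae : (fun x => H x t ^ m * iteratedDeriv 3 (fun z => H z t) x ^ 2) =ᵐ[volume]
      fun x => T ^ m / T ^ 4 * (f (|x| / T) ^ m * f₃ (|x| / T) ^ 2) := by
    filter_upwards [ae_ne_zero] with x hx
    have hp := h.pos (div_nonneg (abs_nonneg x) hT.le)
    rw [funext hH, h.iteratedDeriv_three_selfSimilar_sq hT hx, hH x, Real.mul_rpow hT.le hp.le]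
    ring
  have hi := (integrable_comp_abs_div h.integrableOn_dissipation hT).const_mul (T ^ m / T ^ 4)
  have hnn : ∀ x, 0 ≤ T ^ m / T ^ 4 * (f (|x| / T) ^ m * f₃ (|x| / T) ^ 2) := fun x =>
    mul_nonneg (div_nonneg (Real.rpow_nonneg hT.le m) (by positivity))
      (h.dissipation_nonneg (div_nonneg (abs_nonneg x) hT.le))
  rw [dissipationRate, lintegral_congr_ae (hae.mono fun x hx => congrArg ENNReal.ofReal hx),
    ← ofReal_integral_eq_lintegral_ofReal hi (Eventually.of_forall hnn), integral_const_mul,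
    integral_comp_abs_div (fun y => f y ^ m * f₃ y ^ 2) hT]
  congr 1
  rw [show m - 3 = m - (3 : ℕ) by norm_num, Real.rpow_sub_natCast hT.ne']
  field_simp

lemma dissipationRate_pos_and_lt_top (h : ProfileSystem m α a f f₁ f₂ f₃) {H : ℝ → ℝ → ℝ}
    {t T : ℝ} (hT : 0 < T) (hH : ∀ z, H z t = T * f (|z| / T)) :
    0 < dissipationRate m H t ∧ dissipationRate m H t < ⊤ := by
  rw [h.dissipationRate_eq hT hH]
  have := h.integral_dissipation_pos
  have := Real.rpow_pos_of_pos hT (m - 3)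
  exact ⟨ENNReal.ofReal_pos.2 (by positivity), ENNReal.ofReal_lt_top⟩

lemma setLIntegral_dissipationRate (h : ProfileSystem m α a f f₁ f₂ f₃) {H : ℝ → ℝ → ℝ}
    {T : ℝ → ℝ} {S : Set ℝ} (hS : MeasurableSet S) (hS0 : 0 < volume S) (hT : ∀ s ∈ S, 0 < T s)
    (hH : ∀ s ∈ S, ∀ z, H z s = T s * f (|z| / T s))
    (hi : IntegrableOn (fun s => T s ^ (m - 3)) S) :
    0 < ∫⁻ s in S, dissipationRate m H s ∧ ∫⁻ s in S, dissipationRate m H s < ⊤ := by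
  rw [setLIntegral_congr_fun hS fun s hs => h.dissipationRate_eq (hT s hs) (hH s hs)]
  have hD := h.integral_dissipation_pos
  have hi' := hi.const_mul (2 * ∫ y in Ioi 0, f y ^ m * f₃ y ^ 2)
  refine ⟨?_, Integrable.lintegral_lt_top hi'⟩
  rw [pos_iff_ne_zero, Ne, lintegral_eq_zero_iff' hi'.aemeasurable.ennreal_ofReal]
  intro h0
  have hfalse : ∀ᵐ _ ∂volume.restrict S, False := by
    filter_upwards [h0, ae_restrict_mem hS] with s hs0 hs
    have := Real.rpow_pos_of_pos (hT s hs) (m - 3)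
    exact (ENNReal.ofReal_pos.2 (by positivity)).ne' hs0
  rw [eventually_false_iff_eq_bot, ae_eq_bot, Measure.restrict_eq_zero] at hfalse
  exact hS0.ne' hfalse

end ProfileSystem

/-! ### The two self-similar families -/

theorem mainTheorem3 :
    (∀ (m κ a : ℝ) (f : ℝ → ℝ), 0 < m → m < 4 →
      IsProfile m (1 / (4 - m)) κ a f →
      (∃ d₀ D₀ : ℝ, 0 < d₀ ∧ 0 < D₀ ∧ ∀ t : ℝ, 0 < t →
        Integrable (energyDensityChange (powerSelfSimilar (1 / (4 - m)) f) (cone a) t) ∧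
        -t ^ (1 / (4 - m)) * d₀ < (1 / 2 : ℝ) *
          ∫ x : ℝ, energyDensityChange (powerSelfSimilar (1 / (4 - m)) f) (cone a) t x ∧
        (1 / 2 : ℝ) *
          ∫ x : ℝ, energyDensityChange (powerSelfSimilar (1 / (4 - m)) f) (cone a) t x
            ≤ -t ^ (1 / (4 - m)) * D₀) ∧
      (∀ t : ℝ, 0 < t →
        (0 < dissipationRate m (powerSelfSimilar (1 / (4 - m)) f) t ∧
          dissipationRate m (powerSelfSimilar (1 / (4 - m)) f) t < ⊤) ∧
        0 < ∫⁻ s in Ioo 0 t, dissipationRate m (powerSelfSimilar (1 / (4 - m)) f) s ∧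
        ∫⁻ s in Ioo 0 t, dissipationRate m (powerSelfSimilar (1 / (4 - m)) f) s < ⊤)) ∧
    (∀ (b κ a : ℝ) (f : ℝ → ℝ), 0 < b →
      IsProfile 4 b κ a f →
      (∃ d₀ D₀ : ℝ, 0 < d₀ ∧ 0 < D₀ ∧ ∀ t : ℝ,
        Integrable (energyDensityChange (expSelfSimilar b f) (cone a) t) ∧
        -Real.exp (b * t) * d₀ < (1 / 2 : ℝ) *
          ∫ x : ℝ, energyDensityChange (expSelfSimilar b f) (cone a) t x ∧
        (1 / 2 : ℝ) * ∫ x : ℝ, energyDensityChange (expSelfSimilar b f) (cone a) t x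
            ≤ -Real.exp (b * t) * D₀) ∧
      (∀ t : ℝ,
        (0 < dissipationRate 4 (expSelfSimilar b f) t ∧
          dissipationRate 4 (expSelfSimilar b f) t < ⊤) ∧
        0 < ∫⁻ s in Iio t, dissipationRate 4 (expSelfSimilar b f) s ∧
        ∫⁻ s in Iio t, dissipationRate 4 (expSelfSimilar b f) s < ⊤)) := by
  constructor
  · intro m κ a f hm hm4 hf
    have hα : 0 < 1 / (4 - m) := one_div_pos.2 (by linarith)
    have h := hf.profileSystem hm hm4.le hα
    have hE := h.integral_first_sq_sub_neg
    set E := ∫ y in Ioi 0, (profileDeriv 1 f y ^ 2 - a ^ 2)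
    -- Half the energy change equals `T E` exactly, so `-E` gives equality in the upper bound and
    -- any larger constant gives the strict lower bound.
    refine ⟨⟨-E + 1, -E, by linarith, by linarith, fun t ht => ?_⟩, fun t ht => ?_⟩
    · have hT : 0 < t ^ (1 / (4 - m)) := Real.rpow_pos_of_pos ht _
      refine ⟨h.integrable_energyDensityChange hT fun z => rfl, ?_, ?_⟩ <;>
        rw [h.half_integral_energyDensityChange hT fun z => rfl] <;> linarith
    · refine ⟨h.dissipationRate_pos_and_lt_top (Real.rpow_pos_of_pos ht _) fun z => rfl,
        h.setLIntegral_dissipationRate (T := fun s => s ^ (1 / (4 - m))) measurableSet_Ioo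
          (by simpa using ht) (fun s hs => Real.rpow_pos_of_pos hs.1 _) (fun s _ z => rfl) ?_⟩
      -- With `α = 1/(4 - m)` the rate scales like `s^(α-1)`, which is integrable at `s = 0`.
      have hp : -1 < 1 / (4 - m) * (m - 3) := by
        have : 1 / (4 - m) * (m - 3) = 1 / (4 - m) - 1 := by
          have : 4 - m ≠ 0 := by linarith
          field_simp
          ring
        linarith
      have hi := (intervalIntegrable_iff_integrableOn_Ioo_of_le ht.le).1
        (intervalIntegral.intervalIntegrable_rpow' (a := 0) (b := t) hp)
      refine hi.congr_fun (fun s hs => ?_) measurableSet_Ioo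
      exact Real.rpow_mul hs.1.le _ _
  · intro b κ a f hb hf
    have h := hf.profileSystem (by norm_num) le_rfl hb
    have hE := h.integral_first_sq_sub_neg
    set E := ∫ y in Ioi 0, (profileDeriv 1 f y ^ 2 - a ^ 2)
    refine ⟨⟨-E + 1, -E, by linarith, by linarith, fun t => ?_⟩, fun t => ?_⟩
    · have hT : 0 < Real.exp (b * t) := Real.exp_pos _
      refine ⟨h.integrable_energyDensityChange hT fun z => rfl, ?_, ?_⟩ <;>
        rw [h.half_integral_energyDensityChange hT fun z => rfl] <;> linarith
    · refine ⟨h.dissipationRate_pos_and_lt_top (Real.exp_pos _) fun z => rfl,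
        h.setLIntegral_dissipationRate (T := fun s => Real.exp (b * s)) measurableSet_Iio
          (by simp) (fun s _ => Real.exp_pos _) (fun s _ z => rfl) ?_⟩
      -- For `m = 4` the rate is proportional to `e^{bs}`, integrable at `-∞` because `b > 0`.
      have e : (4 : ℝ) - 3 = 1 := by norm_num
      simp only [e, Real.rpow_one]
      exact (integrableOn_exp_mul_Iic hb t).mono_set Iio_subset_Iic_self
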